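/- Let $k\ge 1$ be an integer and let $T_k$ be the $k$-fan, i.e. the graph formed by $k$ triangles that share exactly one common vertex and are otherwise disjoint. The edges of the complete graph $K_n$ on $n$ labelled vertices are presented to Builder one at a time in uniformly random order, and upon seeing an edge Builder must decide immediately and irrevocably whether to purchase it. A $(t,b)$-strategy is a (deterministic or randomized) online rule for these decisions under which Builder observes the first $t$ edges and purchases at most $b$ of them; $B_s$ denotes the graph on the $n$ vertices formed by the edges purchased among the first $s$ edges. For positive integers $n,t$ put $$b^*=b^*(n,t)=\max\left\{\frac{n^{4k-1}}{t^{3k-1}},\ \frac{n}{\sqrt t}\right\}.$$ Let $t=t(n)$ and $b=b(n)$ be sequences of non-negative integers with $t\le\binom n2$ for all sufficiently large $n$. As usual, $f=o(g)$ and $g=\omega(f)$ mean $f(n)/g(n)\to 0$ as $n\to\infty$ (if $t=0$ we put $b^*=\infty$). (i) If $t=\omega\bigl(n^{(4k-1)/(3k)}\bigr)$ and $b=\omega(b^*)$, then there are $(t,b)$-strategies of Builder, one for each $n$, such that $$\lim_{n\to\infty}\mathbb P(T_k\subseteq B_t)=1 .$$ They can be taken deterministic and such that the decision at each time $s\le t$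 depends only on $s$, on the current graph $B_{s-1}$ and on the edge presented at time $s$. (ii) If $t=o\bigl(n^{(4k-1)/(3k)}\bigr)$ or $b=o(b^*)$, then for every choice of $(t,b)$-strategies of Builder, one for each $n$ (possibly randomized, and possibly using the whole sequence of edges observed so far), $$\lim_{n\to\infty}\mathbb P(T_k\subseteq B_t)=0 .$$ Here $T_k\subseteq B_t$ means that $B_t$ contains a (not necessarily induced) subgraph isomorphic to $T_k$. -/

import Mathlib

open Filter Topology

/-- The fan `T_k`: `k` triangles sharing exactly one vertex, the centre `none`. The other two
vertices of the `i`-th triangle are `some (i, false)` and `some (i, true)`. -/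
def triangleFan (k : ℕ) : SimpleGraph (Option (Fin k × Bool)) where
  Adj
    | none, none => False
    | none, some _ => True
    | some _, none => True
    | some x, some y => x.1 = y.1 ∧ x.2 ≠ y.2
  symm := ⟨by
    rintro (_ | x) (_ | y) h
    · exact h
    · trivial
    · trivial
    · exact ⟨h.1.symm, h.2.symm⟩⟩
  loopless := ⟨by
    rintro (_ | x) h
    · exact h
    · exact h.2 rfl⟩

/-- The edges of the complete graph `K_n` on the vertex set `Fin n`. -/
abbrev CompleteEdge (n : ℕ) : Type := (⊤ : SimpleGraph (Fin n)).edgeSet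

/-- An order of presentation of all `n.choose 2` edges of `K_n`; `π i` is the edge presented at
time `i + 1`. -/
abbrev EdgeOrder (n : ℕ) : Type := Fin (n.choose 2) ≃ CompleteEdge n

instance EdgeOrder.instNonempty (n : ℕ) : Nonempty (EdgeOrder n) := by
  classical
  refine ⟨(Fintype.equivFinOfCardEq ?_).symm⟩
  rw [← SimpleGraph.edgeFinset_card, SimpleGraph.card_edgeFinset_top_eq_card_choose_two,
    Fintype.card_fin]

noncomputable instance EdgeOrder.instFintype (n : ℕ) : Fintype (EdgeOrder n) :=
  Fintype.ofFinite _

/-- The edges presented strictly before the edge `π i`, in their order. -/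
def EdgeOrder.past {n : ℕ} (π : EdgeOrder n) (i : Fin (n.choose 2)) :
    Fin (i : ℕ) → CompleteEdge n :=
  fun j => π ⟨j, j.2.trans i.2⟩

/-- An online decision rule: whether to purchase the edge presented at position `i`, given all the
edges presented earlier, in their order, and the edge presented now. -/
abbrev DecisionRule (n : ℕ) : Type :=
  (i : Fin (n.choose 2)) → (Fin (i : ℕ) → CompleteEdge n) → CompleteEdge n → Prop

/-- The set of edges purchased among the first `s` presented ones. -/
def DecisionRule.bought {n : ℕ} (buy : DecisionRule n) (π : EdgeOrder n) (s : ℕ) :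
    Set (CompleteEdge n) :=
  {e | ∃ i : Fin (n.choose 2), (i : ℕ) < s ∧ buy i (π.past i) (π i) ∧ π i = e}

/-- A deterministic `(t, b)`-strategy of Builder: an online decision rule that purchases at most
`b` edges among the first `t` presented ones, whatever the order of presentation. -/
structure Strategy (n t b : ℕ) where
  buy : DecisionRule n
  budget : ∀ π : EdgeOrder n, (buy.bought π t).ncard ≤ b

namespace Strategy

variable {n t b : ℕ}

/-- Builder's graph `B_s`, consisting of the edges purchased by time `s`. -/
def graphAt (σ : Strategy n t b) (π : EdgeOrder n) (s : ℕ) : SimpleGraph (Fin n) :=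
  SimpleGraph.fromEdgeSet (Subtype.val '' σ.buy.bought π s)

/-- The strategy only uses the current time, Builder's current graph and the edge presented now;
it need not remember the edges that it declined. -/
def IsGraphBased (σ : Strategy n t b) : Prop :=
  ∀ (π π' : EdgeOrder n) (i : Fin (n.choose 2)), (i : ℕ) < t →
    σ.graphAt π i = σ.graphAt π' i → π i = π' i →
      (σ.buy i (π.past i) (π i) ↔ σ.buy i (π'.past i) (π' i))

end Strategy

/-- A randomized `(t, b)`-strategy: a random choice of a deterministic `(t, b)`-strategy, made
independently of the order of presentation. -/
abbrev RandomizedStrategy (n t b : ℕ) : Type := PMF (Strategy n t b)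

/-- The distribution of Builder's final graph `B_t`, when the edges of `K_n` are presented in
uniformly random order and, independently, Builder's strategy is drawn from `p`. -/
noncomputable def RandomizedStrategy.finalGraph {n t b : ℕ} (p : RandomizedStrategy n t b) :
    PMF (SimpleGraph (Fin n)) :=
  p.bind fun σ => (PMF.uniformOfFintype (EdgeOrder n)).map fun π => σ.graphAt π t

/-- The probability that `B_t` contains a (not necessarily induced) copy of `H`. -/
noncomputable def RandomizedStrategy.probContains {n t b : ℕ} {V : Type}
    (p : RandomizedStrategy n t b) (H : SimpleGraph V) : ENNReal :=
  p.finalGraph.toOuterMeasure {B | H.IsContained B}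

/-- The deterministic strategy `σ` as a (degenerate) randomized one. -/
noncomputable def Strategy.toRandomized {n t b : ℕ} (σ : Strategy n t b) :
    RandomizedStrategy n t b :=
  PMF.pure σ

/-- The budget threshold `b* = max {n^(4k-1) / t^(3k-1), n / √t}`, for `1 ≤ k`. For `t = 0` this is `0`,
so that `b / b* = 0`, as it would be with the convention `b* = ∞`. -/
noncomputable def budgetThreshold (k n t : ℕ) : ℝ :=
  max ((n : ℝ) ^ (4 * k - 1) / (t : ℝ) ^ (3 * k - 1)) ((n : ℝ) / √(t : ℝ))

/-- The time threshold `n^((4k-1)/(3k))`. -/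
noncomputable def timeThreshold (k n : ℕ) : ℝ :=
  (n : ℝ) ^ ((4 * (k : ℝ) - 1) / (3 * (k : ℝ)))

/-! Write N for `n.choose 2`; implied constants depend on k only. Impossibility rests on two first
moment bounds, available because the unseen edges stay in uniform order given what Builder has seen
(`EdgeOrder.card_later_before_mul_le`). The earliest edge of a fan in B_t is one of at most min(b,
t) bought edges. It lies in O(n^(2k-1)) copies of the fan, each completed with probability at most
(t/N)^(3k-1). This gives O(min(b, t) t^(3k-1) / n^(4k-1))
(`Strategy.successCount_triangleFan_mul_le`). Likewise the first two edges of a triangle form one of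
at most b^2 pairs of bought edges, and the third arrives with probability at most t/N. This gives
O(b^2 t / n^2) (`Strategy.successCount_triangleFan_mul_choose_le`). Randomized strategies only
average these bounds.

For existence, fix r centres and k pairs of disjoint classes of m leaves, with m of order n/k.
Builder buys centre-leaf edges in a first phase; then, for t/2 steps, chords between paired classes
that close a triangle at a centre. Let D = min(t/n, n/√t) and give the first phase length about
nD/2. A centre then receives O(D) edges, and each pair of classes yields an expected number of
triangles at it of order μ = D^2 t / n^2 = min(t^3/n^4, 1). A centre carries a fan with probability
of order μ^k, so r = ⌈L/μ^k⌉ centres suffice when L is large, at cost O(L D / μ^k) = O(L b*). The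
time hypothesis gives r ≤ n/2, so there is room for the centres.

The second moment method for the number of timely fans, with Markov's inequality for the cost
(`le_successCount_ofRule`), bounds the success probability below by (1 - o(1)) / (1 + o(1) + C/L) -
O(L b*/b). Let n, then L, tend to infinity. A graph-based strategy with the largest success count
serves all L at once (`exists_isGraphBased_forall_successCount_le`). -/

/-! ### Exchangeability of positions in a random order. -/

section PositionCounting

variable {P E ι : Type*} [Fintype P] [DecidableEq P] [DecidableEq E] [Fintype ι]

/-- Two families of distinct points of `U` are related by a permutation supported on `U`. -/
theorem exists_perm_supported_extending (U : Finset P) (q q' : ι ↪ P) (hq : ∀ j, q j ∈ U)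
    (hq' : ∀ j, q' j ∈ U) :
    ∃ σ : Equiv.Perm P, (∀ p, p ∉ U → σ p = p) ∧ ∀ j, σ (q j) = q' j := by
  classical
  let Q : ι → U := fun j => ⟨q j, hq j⟩
  let Q' : ι → U := fun j => ⟨q' j, hq' j⟩
  have hQ : Function.Injective Q := fun a b h => q.injective (congrArg Subtype.val h)
  have hQ' : Function.Injective Q' := fun a b h => q'.injective (congrArg Subtype.val h)
  -- The matching of the values of `q` with those of `q'` extends to a permutation of the finite set
  -- `U`, and then by the identity outside `U`.
  let e : {p // p ∈ Set.range Q} ≃ {p // p ∈ Set.range Q'} :=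
    (Equiv.ofInjective Q hQ).symm.trans (Equiv.ofInjective Q' hQ')
  refine ⟨Equiv.Perm.ofSubtype e.extendSubtype, fun p hp =>
    Equiv.Perm.ofSubtype_apply_of_not_mem _ hp, fun j => ?_⟩
  rw [Equiv.Perm.ofSubtype_apply_of_mem _ (hq j)]
  have h : e.extendSubtype (Q j) = Q' j := by
    rw [Equiv.extendSubtype_apply_of_mem _ _ ⟨j, rfl⟩]
    simp only [e, Equiv.trans_apply]
    rw [Equiv.ofInjective_symm_apply]
    rfl
  exact congrArg Subtype.val h

theorem card_filter_embedding_mem (W : Finset P) :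
    (Finset.univ.filter fun q : ι ↪ P => ∀ j, q j ∈ W).card =
      W.card.descFactorial (Fintype.card ι) := by
  classical
  rw [← Fintype.card_coe W, ← Fintype.card_embedding_eq, ← Fintype.card_coe]
  refine Fintype.card_congr ⟨fun q => ⟨fun j => ⟨q.1 j, (Finset.mem_filter.1 q.2).2 j⟩,
    fun a b h => q.1.injective (by simpa using h)⟩,
    fun q => ⟨q.trans (Function.Embedding.subtype _), by simp⟩, fun q => by ext; rfl,
    fun q => by ext; rfl⟩

/-- If membership in `A` is not affected by rearranging the positions in `U`, then conditionally
on `A` the positions of the given objects, as far as they lie in `U`, are uniformly distributed. -/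
theorem exists_card_filter_symm_mem (A : Finset (P ≃ E)) (U : Finset P)
    (hA : ∀ π π' : P ≃ E, (∀ p, p ∉ U → π p = π' p) → π ∈ A → π' ∈ A) (F : ι ↪ E) :
    ∃ c : ℕ, ∀ W : ι → Finset P, (∀ j, W j ⊆ U) →
      (A.filter fun π => ∀ j, π.symm (F j) ∈ W j).card =
        c * (Finset.univ.filter fun q : ι ↪ P => ∀ j, q j ∈ W j).card := by
  classical
  -- Composing with a permutation supported on `U` injects the orders in `A` that put `F` at `q`
  -- into those that put it at `q'`. By symmetry the counts agree; the common value is `c`.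
  have key : ∀ q q' : ι ↪ P, (∀ j, q j ∈ U) → (∀ j, q' j ∈ U) →
      (A.filter fun π => ∀ j, π (q j) = F j).card ≤
        (A.filter fun π => ∀ j, π (q' j) = F j).card := by
    intro q q' hq hq'
    obtain ⟨σ, hσ, hσq⟩ := exists_perm_supported_extending U q q' hq hq'
    have hσ' : ∀ p, p ∉ U → σ.symm p = p := fun p hp => by
      rw [Equiv.symm_apply_eq, hσ p hp]
    refine Finset.card_le_card_of_injOn (fun π => σ.symm.trans π) ?_ ?_
    · intro π hπ
      simp only [Finset.coe_filter, Set.mem_ofPred_eq] at hπ ⊢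
      refine ⟨hA π _ (fun p hp => by simp [hσ' p hp]) hπ.1, fun j => ?_⟩
      rw [Equiv.trans_apply, ← hσq j, Equiv.symm_apply_apply]
      exact hπ.2 j
    · intro π _ π' _ h
      ext p
      have := congrArg (fun e : P ≃ E => e (σ p)) h
      simpa using this
  obtain ⟨c, hc⟩ : ∃ c : ℕ, ∀ q : ι ↪ P, (∀ j, q j ∈ U) →
      (A.filter fun π => ∀ j, π (q j) = F j).card = c := by
    by_cases h : ∃ q : ι ↪ P, ∀ j, q j ∈ U
    · obtain ⟨q, hq⟩ := h
      exact ⟨_, fun q' hq' => le_antisymm (key q' q hq' hq) (key q q' hq hq')⟩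
    · push Not at h
      exact ⟨0, fun q hq => absurd hq (by push Not; exact h q)⟩
  refine ⟨c, fun W hW => ?_⟩
  have hfib : (A.filter fun π => ∀ j, π.symm (F j) ∈ W j) =
      (Finset.univ.filter fun q : ι ↪ P => ∀ j, q j ∈ W j).biUnion
        (fun q : ι ↪ P => A.filter fun π => ∀ j, π (q j) = F j) := by
    ext π
    simp only [Finset.mem_filter, Finset.mem_biUnion, Finset.mem_univ, true_and]
    constructor
    · rintro ⟨hπ, h⟩
      exact ⟨F.trans π.symm.toEmbedding, h, hπ, by simp⟩
    · rintro ⟨q, hq, hπ, h⟩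
      refine ⟨hπ, fun j => ?_⟩
      rw [← h j, Equiv.symm_apply_apply]
      exact hq j
  rw [hfib, Finset.card_biUnion]
  · rw [Finset.sum_const_nat (m := c), mul_comm]
    intro q hq
    exact hc q fun j => hW j ((Finset.mem_filter.1 hq).2 j)
  · intro q _ q' _ hne
    rw [Function.onFun, Finset.disjoint_left]
    intro π h h'
    refine hne (Function.Embedding.ext fun j => π.injective ?_)
    rw [(Finset.mem_filter.1 h).2 j, (Finset.mem_filter.1 h').2 j]

end PositionCounting

/-! ### Conditional probability that given edges are still to arrive in time. -/

/-- Factor by factor, (t - i - j) / (N - i - j) ≤ t / N because t ≤ N; truncated subtraction makes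
the left factor zero when t < i + j. -/
theorem Nat.descFactorial_mul_pow_le (t N i m : ℕ) (h : t ≤ N) :
    (t - i).descFactorial m * N ^ m ≤ t ^ m * (N - i).descFactorial m := by
  induction m with
  | zero => simp
  | succ m ih =>
    rw [Nat.descFactorial_succ, Nat.descFactorial_succ, pow_succ, pow_succ]
    have h1 : (t - i - m) * N ≤ t * (N - i - m) := by
      rcases Nat.lt_or_ge t (i + m) with h2 | h2
      · have : t - i - m = 0 := by omega
        simp [this]
      · obtain ⟨a, rfl⟩ := Nat.exists_eq_add_of_le h2
        obtain ⟨d, rfl⟩ := Nat.exists_eq_add_of_le h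
        have e1 : i + m + a - i - m = a := by omega
        have e2 : i + m + a + d - i - m = a + d := by omega
        rw [e1, e2]
        nlinarith [Nat.zero_le (i * d), Nat.zero_le (m * d)]
    calc (t - i - m) * (t - i).descFactorial m * (N ^ m * N)
        = ((t - i - m) * N) * ((t - i).descFactorial m * N ^ m) := by ring
      _ ≤ (t * (N - i - m)) * (t ^ m * (N - i).descFactorial m) := Nat.mul_le_mul h1 ih
      _ = _ := by ring

/-- Given the first `i + 1` presented edges, any further edges all arrive before time `t` with
conditional probability at most what it would be for independent uniform positions. -/
theorem EdgeOrder.card_later_before_mul_le {n t : ℕ} (ht : t ≤ n.choose 2)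
    (i : Fin (n.choose 2)) (A : Finset (EdgeOrder n))
    (hA : ∀ π π' : EdgeOrder n, (∀ j, j ≤ i → π j = π' j) → π ∈ A → π' ∈ A)
    (F : Finset (CompleteEdge n)) :
    (A.filter fun π => ∀ e ∈ F, i < π.symm e ∧ (π.symm e : ℕ) < t).card * n.choose 2 ^ F.card ≤
      t ^ F.card * A.card := by
  classical
  -- Membership in `A` ignores the positions after `i`, so one constant `c` governs both `U`, all
  -- later positions, and `W`, those before `t`. The ratio of the two counts is the conditional
  -- probability.
  obtain ⟨c, hc⟩ := exists_card_filter_symm_mem A (Finset.univ.filter fun j => i < j)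
    (fun π π' h => hA π π' fun j hj => h j (by simpa using hj))
    (Function.Embedding.subtype (· ∈ F))
  set U : Finset (Fin (n.choose 2)) := Finset.univ.filter fun j => i < j with hU
  set W : Finset (Fin (n.choose 2)) := Finset.univ.filter fun j => i < j ∧ (j : ℕ) < t with hW
  have hWU : W ⊆ U := fun j hj => by simp [hU, hW] at hj ⊢; exact hj.1
  have h1 := hc (fun _ => W) fun _ => hWU
  have h2 := hc (fun _ => U) fun _ => subset_rfl
  rw [card_filter_embedding_mem] at h1 h2
  have hUc : U.card = n.choose 2 - (i + 1) := by
    have : U = Finset.Ioi i := by ext; simp [hU]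
    rw [this, Fin.card_Ioi]; omega
  have hWc : W.card = t - (i + 1) := by
    have : W.map Fin.valEmbedding = Finset.Ioo (i : ℕ) t := by
      ext a
      simp only [hW, Finset.mem_map, Finset.mem_filter, Finset.mem_univ, true_and,
        Fin.valEmbedding_apply, Finset.mem_Ioo]
      constructor
      · rintro ⟨j, ⟨h, h'⟩, rfl⟩; exact ⟨h, h'⟩
      · rintro ⟨h, h'⟩; exact ⟨⟨a, h'.trans_le ht⟩, ⟨h, h'⟩, rfl⟩
    rw [← Finset.card_map Fin.valEmbedding, this, Nat.card_Ioo]; omega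
  rw [Fintype.card_coe] at h1 h2
  have h3 : (A.filter fun π => ∀ e ∈ F, i < π.symm e ∧ (π.symm e : ℕ) < t) =
      A.filter fun π => ∀ j : F, π.symm (Function.Embedding.subtype (· ∈ F) j) ∈ W := by
    refine Finset.filter_congr fun π _ => ?_
    simp [hW]
  have h4 : c * U.card.descFactorial F.card ≤ A.card :=
    h2 ▸ Finset.card_filter_le _ _
  rw [h3, h1]
  calc c * W.card.descFactorial F.card * n.choose 2 ^ F.card
      = c * (W.card.descFactorial F.card * n.choose 2 ^ F.card) := by ring
    _ ≤ c * (t ^ F.card * U.card.descFactorial F.card) := by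
        rw [hWc, hUc]; exact Nat.mul_le_mul_left _ (Nat.descFactorial_mul_pow_le _ _ _ _ ht)
    _ = t ^ F.card * (c * U.card.descFactorial F.card) := by ring
    _ ≤ _ := Nat.mul_le_mul_left _ h4

/-! ### Edges of fans and of their copies. -/

/-- The edges of the fan `T_k`: `(i, none)` is the edge of the `i`-th triangle opposite to the
centre, and `(i, some β)` is the edge joining the centre to `some (i, β)`. -/
def fanEdge {k : ℕ} : Fin k × Option Bool → Sym2 (Option (Fin k × Bool))
  | (i, none) => s(some (i, false), some (i, true))
  | (i, some β) => s(none, some (i, β))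

theorem fanEdge_injective {k : ℕ} : Function.Injective (fanEdge (k := k)) := by
  rintro ⟨i, _ | β⟩ ⟨j, _ | γ⟩ h <;> simp [fanEdge] at h ⊢ <;> tauto

theorem fanEdge_mem_edgeSet {k : ℕ} (j : Fin k × Option Bool) :
    fanEdge j ∈ (triangleFan k).edgeSet := by
  obtain ⟨i, _ | β⟩ := j <;> simp [fanEdge, triangleFan]

/-- The edges of the copy of `T_k` in `K_n` given by an injection of its vertices. -/
def fanCopyEdge {k n : ℕ} (f : Option (Fin k × Bool) ↪ Fin n) (j : Fin k × Option Bool) :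
    CompleteEdge n :=
  ⟨(fanEdge j).map f, by
    have h := fanEdge_mem_edgeSet j
    induction hj : fanEdge j with
    | _ u v =>
      rw [hj] at h
      simpa using ((SimpleGraph.mem_edgeSet _).1 h).ne⟩

theorem fanCopyEdge_injective {k n : ℕ} (f : Option (Fin k × Bool) ↪ Fin n) :
    Function.Injective (fanCopyEdge f) := fun _ _ h =>
  fanEdge_injective (Sym2.map.injective f.injective (congrArg Subtype.val h))

/-! ### Purchased positions and success probabilities. -/

namespace Strategy

variable {n t b : ℕ}

theorem graphAt_adj (σ : Strategy n t b) (π : EdgeOrder n) (s : ℕ) (e : CompleteEdge n)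
    {x y : Fin n} (he : e.1 = s(x, y)) :
    (σ.graphAt π s).Adj x y ↔ e ∈ σ.buy.bought π s := by
  rw [graphAt, SimpleGraph.fromEdgeSet_adj, ← he]
  constructor
  · rintro ⟨⟨e', h, h'⟩, _⟩
    rwa [← Subtype.ext h']
  · intro h
    refine ⟨⟨e, h, rfl⟩, ?_⟩
    have := e.2
    rw [he] at this
    simpa using this

open Classical in
/-- The positions before `s` at which Builder purchases. -/
noncomputable def boughtPos (σ : Strategy n t b) (π : EdgeOrder n) (s : ℕ) :
    Finset (Fin (n.choose 2)) :=
  Finset.univ.filter fun i => (i : ℕ) < s ∧ σ.buy i (π.past i) (π i)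

theorem mem_boughtPos {σ : Strategy n t b} {π : EdgeOrder n} {s : ℕ} {i : Fin (n.choose 2)} :
    i ∈ σ.boughtPos π s ↔ (i : ℕ) < s ∧ σ.buy i (π.past i) (π i) := by
  simp [boughtPos]

theorem mem_bought_iff {σ : Strategy n t b} {π : EdgeOrder n} {s : ℕ} {e : CompleteEdge n} :
    e ∈ σ.buy.bought π s ↔ π.symm e ∈ σ.boughtPos π s := by
  rw [mem_boughtPos]
  constructor
  · rintro ⟨i, h, h', rfl⟩
    rw [Equiv.symm_apply_apply]
    exact ⟨h, h'⟩
  · rintro ⟨h, h'⟩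
    exact ⟨π.symm e, h, h', by simp⟩

theorem card_boughtPos (σ : Strategy n t b) (π : EdgeOrder n) (s : ℕ) :
    (σ.boughtPos π s).card = (σ.buy.bought π s).ncard := by
  have : σ.buy.bought π s = π '' (σ.boughtPos π s : Set (Fin (n.choose 2))) := by
    ext e
    rw [mem_bought_iff]
    constructor
    · intro h; exact ⟨_, h, by simp⟩
    · rintro ⟨i, h, rfl⟩; simpa using h
  rw [this, Set.ncard_image_of_injective _ π.injective, Set.ncard_coe_finset]

theorem card_boughtPos_le (σ : Strategy n t b) (π : EdgeOrder n) :
    (σ.boughtPos π t).card ≤ b := by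
  rw [card_boughtPos]; exact σ.budget π

theorem card_boughtPos_le_time (σ : Strategy n t b) (π : EdgeOrder n) :
    (σ.boughtPos π t).card ≤ t := by
  rw [← Finset.card_map Fin.valEmbedding]
  refine (Finset.card_le_card (t := Finset.range t) ?_).trans_eq (Finset.card_range t)
  intro i hi
  obtain ⟨j, hj, rfl⟩ := Finset.mem_map.1 hi
  simpa using (mem_boughtPos.1 hj).1

/-- Being online means that later edges have no influence. This makes purchase events admissible as
the set `A` in `EdgeOrder.card_later_before_mul_le`. -/
theorem buy_congr (σ : Strategy n t b) {π π' : EdgeOrder n} {i : Fin (n.choose 2)}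
    (h : ∀ j, j ≤ i → π j = π' j) :
    σ.buy i (π.past i) (π i) ↔ σ.buy i (π'.past i) (π' i) := by
  have : π.past i = π'.past i := by
    funext j
    exact h _ (Fin.le_def.2 j.2.le)
  rw [this, h i le_rfl]

open Classical in
/-- The number of orders of presentation for which Builder's final graph contains `H`. -/
noncomputable def successCount {V : Type} (σ : Strategy n t b) (H : SimpleGraph V) : ℕ :=
  (Finset.univ.filter fun π : EdgeOrder n => H.IsContained (σ.graphAt π t)).card

theorem probContains_toRandomized {V : Type} (σ : Strategy n t b) (H : SimpleGraph V) :
    σ.toRandomized.probContains H =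
      (σ.successCount H : ENNReal) / (Fintype.card (EdgeOrder n) : ENNReal) := by
  classical
  rw [RandomizedStrategy.probContains, RandomizedStrategy.finalGraph, toRandomized, PMF.pure_bind,
    PMF.toOuterMeasure_map_apply, PMF.toOuterMeasure_uniformOfFintype_apply, successCount,
    ← Set.toFinset_card]
  congr 3
  ext π
  simp

end Strategy

/-- The strategy is drawn independently of the order, so its success probability is an average over
deterministic strategies. -/
theorem RandomizedStrategy.probContains_le {n t b : ℕ} {V : Type} (p : RandomizedStrategy n t b)
    (H : SimpleGraph V) (c : ENNReal)
    (h : ∀ σ : Strategy n t b, σ.toRandomized.probContains H ≤ c) : p.probContains H ≤ c := by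
  have h1 : p.probContains H = ∑' σ, p σ * σ.toRandomized.probContains H := by
    rw [RandomizedStrategy.probContains, RandomizedStrategy.finalGraph,
      PMF.toOuterMeasure_bind_apply]
    simp only [RandomizedStrategy.probContains, RandomizedStrategy.finalGraph,
      Strategy.toRandomized, PMF.pure_bind]
  rw [h1]
  calc ∑' σ, p σ * σ.toRandomized.probContains H ≤ ∑' σ, p σ * c := by
        gcongr with σ; exact h σ
    _ = c := by rw [ENNReal.tsum_mul_right, p.tsum_coe, one_mul]

/-! ### First moment bound for fans. -/

section FirstMoment

theorem card_filter_apply_pair_le {V : Type*} [Fintype V] [DecidableEq V] {n : ℕ} {u v : V}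
    (huv : u ≠ v) (x y : Fin n) :
    (Finset.univ.filter fun f : V → Fin n => f u = x ∧ f v = y).card ≤
      n ^ (Fintype.card V - 2) := by
  have : (Finset.univ.filter fun f : V → Fin n => f u = x ∧ f v = y) ⊆
      Fintype.piFinset fun w => if w = u then {x} else if w = v then {y} else Finset.univ := by
    intro f hf
    simp only [Finset.mem_filter, Finset.mem_univ, true_and] at hf
    rw [Fintype.mem_piFinset]
    intro w
    split_ifs with h1 h2 <;> simp [*]
  refine (Finset.card_le_card this).trans ?_
  rw [Fintype.card_piFinset]
  rw [← Finset.prod_subset (Finset.subset_univ ((Finset.univ.erase u).erase v))]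
  · rw [Finset.prod_congr rfl (g := fun _ => n)]
    · rw [Finset.prod_const, Finset.card_erase_of_mem (by simp [huv.symm]),
        Finset.card_erase_of_mem (by simp), Finset.card_univ, Nat.sub_sub]
    · intro w hw
      simp only [Finset.mem_erase] at hw
      simp [hw.1, hw.2.1]
  · intro w _ hw
    simp only [Finset.mem_erase, Finset.mem_univ, and_true, not_and_or, not_not] at hw
    split_ifs <;> simp_all

/-- One edge fixes two of the 2k + 1 vertices, in one of two orientations, and leaves 2k - 1
vertices free. -/
theorem card_filter_fanCopyEdge_le {k n : ℕ} (j : Fin k × Option Bool) (e : CompleteEdge n) :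
    (Finset.univ.filter fun f : Option (Fin k × Bool) ↪ Fin n => fanCopyEdge f j = e).card ≤
      2 * n ^ (2 * k - 1) := by
  classical
  obtain ⟨e, he⟩ := e
  induction e with
  | _ x y =>
  have h := fanEdge_mem_edgeSet j
  induction hj : fanEdge j with
  | _ u v =>
  rw [hj, SimpleGraph.mem_edgeSet] at h
  have hsub : ((Finset.univ.filter fun f : Option (Fin k × Bool) ↪ Fin n =>
      fanCopyEdge f j = ⟨s(x, y), he⟩).map ⟨fun (f : Option (Fin k × Bool) ↪ Fin n) x => f x,
        fun _ _ h => DFunLike.coe_injective h⟩) ⊆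
      (Finset.univ.filter fun f : Option (Fin k × Bool) → Fin n => f u = x ∧ f v = y) ∪
      (Finset.univ.filter fun f : Option (Fin k × Bool) → Fin n => f u = y ∧ f v = x) := by
    intro g hg
    obtain ⟨f, hf, rfl⟩ := Finset.mem_map.1 hg
    have hf' := congrArg Subtype.val (Finset.mem_filter.1 hf).2
    simp only [fanCopyEdge, hj, Sym2.map_mk, Sym2.eq_iff] at hf'
    simp only [Finset.mem_union, Finset.mem_filter, Finset.mem_univ, true_and]
    exact hf'
  rw [← Finset.card_map]
  refine (Finset.card_le_card hsub).trans ((Finset.card_union_le _ _).trans ?_)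
  have hc : Fintype.card (Option (Fin k × Bool)) - 2 = 2 * k - 1 := by
    simp; omega
  rw [two_mul, ← hc]
  exact Nat.add_le_add (card_filter_apply_pair_le h.ne _ _) (card_filter_apply_pair_le h.ne _ _)

namespace Strategy

variable {n t b : ℕ}

/-- Union bound over a copy of the fan, the role of its earliest edge and the position of that edge.
The earliest edge must be bought and the other 3k - 1 edges must follow before time t. The factor 6k
counts 3k roles and two orientations. -/
theorem successCount_triangleFan_mul_le (σ : Strategy n t b) (ht : t ≤ n.choose 2) {k : ℕ}
    (hk : 1 ≤ k) :
    σ.successCount (triangleFan k) * n.choose 2 ^ (3 * k - 1) ≤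
      6 * k * n ^ (2 * k - 1) * min b t * t ^ (3 * k - 1) * Fintype.card (EdgeOrder n) := by
  classical
  let A : (Option (Fin k × Bool) ↪ Fin n) × (Fin k × Option Bool) × Fin (n.choose 2) →
      Finset (EdgeOrder n) := fun x => Finset.univ.filter fun π =>
    x.2.2 ∈ σ.boughtPos π t ∧ π x.2.2 = fanCopyEdge x.1 x.2.1
  let F : (Option (Fin k × Bool) ↪ Fin n) × (Fin k × Option Bool) × Fin (n.choose 2) →
      Finset (CompleteEdge n) := fun x =>
    (Finset.univ.erase x.2.1).map ⟨fanCopyEdge x.1, fanCopyEdge_injective x.1⟩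
  have hF : ∀ x, (F x).card = 3 * k - 1 := by
    intro x
    rw [Finset.card_map, Finset.card_erase_of_mem (Finset.mem_univ _), Finset.card_univ]
    simp; omega
  have hcover : (Finset.univ.filter fun π : EdgeOrder n =>
      (triangleFan k).IsContained (σ.graphAt π t)) ⊆ Finset.univ.biUnion fun x =>
        (A x).filter fun π => ∀ e ∈ F x, x.2.2 < π.symm e ∧ (π.symm e : ℕ) < t := by
    intro π hπ
    obtain ⟨φ⟩ := (Finset.mem_filter.1 hπ).2
    let f : Option (Fin k × Bool) ↪ Fin n := ⟨φ, φ.injective⟩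
    have hb : ∀ j, π.symm (fanCopyEdge f j) ∈ σ.boughtPos π t := by
      intro j
      rw [← mem_bought_iff]
      have h := fanEdge_mem_edgeSet j
      induction hj : fanEdge j with
      | _ u v =>
      rw [hj, SimpleGraph.mem_edgeSet] at h
      exact (σ.graphAt_adj π t (fanCopyEdge f j) (x := φ u) (y := φ v)
        (by simp [fanCopyEdge, hj, f])).1 (φ.toHom.map_adj h)
    -- `j` is the role of the earliest edge of the copy.
    obtain ⟨j, -, hj⟩ := Finset.exists_min_image (Finset.univ : Finset (Fin k × Option Bool))
      (fun j => π.symm (fanCopyEdge f j)) ⟨(⟨0, hk⟩, none), Finset.mem_univ _⟩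
    refine Finset.mem_biUnion.2 ⟨(f, j, π.symm (fanCopyEdge f j)), Finset.mem_univ _, ?_⟩
    refine Finset.mem_filter.2 ⟨Finset.mem_filter.2 ⟨Finset.mem_univ _, hb j, by simp⟩, ?_⟩
    intro e he
    obtain ⟨j', hj', rfl⟩ := Finset.mem_map.1 he
    refine ⟨lt_of_le_of_ne (hj j' (Finset.mem_univ _)) fun h => ?_, (mem_boughtPos.1 (hb j')).1⟩
    exact (Finset.mem_erase.1 hj').1 (fanCopyEdge_injective f (π.symm.injective h)).symm
  have hA : ∀ x, ((A x).filter fun π => ∀ e ∈ F x, x.2.2 < π.symm e ∧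
      (π.symm e : ℕ) < t).card * n.choose 2 ^ (3 * k - 1) ≤ t ^ (3 * k - 1) * (A x).card := by
    intro x
    rw [← hF x]
    refine EdgeOrder.card_later_before_mul_le ht x.2.2 (A x) ?_ (F x)
    -- The event `A x` is decided once the edge at position `x.2.2` has been presented.
    intro π π' h hπ
    simp only [A, Finset.mem_filter, Finset.mem_univ, true_and, mem_boughtPos] at hπ ⊢
    rwa [← σ.buy_congr h, ← h _ le_rfl]
  have hsum : ∑ x, (A x).card ≤
      6 * k * n ^ (2 * k - 1) * min b t * Fintype.card (EdgeOrder n) := by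
    -- Double counting: for a fixed order only the bought positions contribute, at most `min b t` of
    -- them.
    calc ∑ x, (A x).card
        = ∑ π : EdgeOrder n, ∑ i ∈ σ.boughtPos π t, ∑ j : Fin k × Option Bool,
            (Finset.univ.filter fun f : Option (Fin k × Bool) ↪ Fin n =>
              fanCopyEdge f j = π i).card := by
          simp only [A, Finset.card_filter]
          rw [Finset.sum_comm]
          refine Finset.sum_congr rfl fun π _ => ?_
          rw [Fintype.sum_prod_type, Finset.sum_comm, Fintype.sum_prod_type, Finset.sum_comm,
            ← Finset.sum_subset (Finset.subset_univ (σ.boughtPos π t))]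
          · refine Finset.sum_congr rfl fun i hi => Finset.sum_congr rfl fun j _ =>
              Finset.sum_congr rfl fun f _ => ?_
            simp only [hi, true_and, eq_comm]
          · intro i _ hi
            simp [hi]
      _ ≤ ∑ π : EdgeOrder n, ∑ i ∈ σ.boughtPos π t, ∑ j : Fin k × Option Bool,
            2 * n ^ (2 * k - 1) := by
          gcongr; exact card_filter_fanCopyEdge_le _ _
      _ = ∑ π : EdgeOrder n, (σ.boughtPos π t).card * (6 * k * n ^ (2 * k - 1)) := by
          simp only [Finset.sum_const, smul_eq_mul, Finset.card_univ, Fintype.card_prod,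
            Fintype.card_fin, Fintype.card_option, Fintype.card_bool]
          refine Finset.sum_congr rfl fun π _ => by ring
      _ ≤ ∑ π : EdgeOrder n, min b t * (6 * k * n ^ (2 * k - 1)) := by
          gcongr with π
          exact le_min (σ.card_boughtPos_le π) (σ.card_boughtPos_le_time π)
      _ = _ := by
          simp only [Finset.sum_const, smul_eq_mul, Finset.card_univ]; ring
  calc σ.successCount (triangleFan k) * n.choose 2 ^ (3 * k - 1)
      ≤ (∑ x, ((A x).filter fun π => ∀ e ∈ F x, x.2.2 < π.symm e ∧
          (π.symm e : ℕ) < t).card) * n.choose 2 ^ (3 * k - 1) :=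
        Nat.mul_le_mul_right _ ((Finset.card_le_card hcover).trans Finset.card_biUnion_le)
    _ ≤ ∑ x, t ^ (3 * k - 1) * (A x).card := by
        rw [Finset.sum_mul]; exact Finset.sum_le_sum fun x _ => hA x
    _ ≤ _ := by
        rw [← Finset.mul_sum]
        refine (Nat.mul_le_mul_left _ hsum).trans_eq (by ring)

end Strategy

/-! ### First moment bound for triangles. -/

theorem card_filter_sym2_mk_le {V : Type*} [Fintype V] [DecidableEq V] (e : Sym2 V) :
    (Finset.univ.filter fun p : V × V => s(p.1, p.2) = e).card ≤ 2 := by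
  induction e with
  | _ x y =>
  refine (Finset.card_le_card (t := {(x, y), (y, x)}) ?_).trans Finset.card_le_two
  rintro ⟨u, v⟩ h
  simpa using h

/-- Ordered triples of distinct vertices of `K_n`. -/
abbrev DistinctTriple (n : ℕ) : Type :=
  {p : Fin n × Fin n × Fin n // p.1 ≠ p.2.1 ∧ p.2.1 ≠ p.2.2 ∧ p.1 ≠ p.2.2}

namespace DistinctTriple

variable {n : ℕ} (p : DistinctTriple n)

/-- The edge between the first two vertices. -/
def edge₁₂ : CompleteEdge n := ⟨s(p.1.1, p.1.2.1), by simpa using p.2.1⟩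

/-- The edge between the last two vertices. -/
def edge₂₃ : CompleteEdge n := ⟨s(p.1.2.1, p.1.2.2), by simpa using p.2.2.1⟩

/-- The edge between the first and the last vertex. -/
def edge₁₃ : CompleteEdge n := ⟨s(p.1.1, p.1.2.2), by simpa using p.2.2.2⟩

/-- Each of the two edges can be oriented in two ways, and the orientations determine the triple. -/
theorem card_filter_edge_le (e e' : CompleteEdge n) :
    (Finset.univ.filter fun p : DistinctTriple n => p.edge₁₂ = e ∧ p.edge₂₃ = e').card ≤ 4 := by
  calc _ ≤ ((Finset.univ.filter fun p : Fin n × Fin n => s(p.1, p.2) = e.1) ×ˢ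
        (Finset.univ.filter fun p : Fin n × Fin n => s(p.1, p.2) = e'.1)).card := by
        refine Finset.card_le_card_of_injOn
          (fun p => ((p.1.1, p.1.2.1), (p.1.2.1, p.1.2.2))) ?_ ?_
        · intro p hp
          have hp := (Finset.mem_filter.1 hp).2
          have h1 := congrArg Subtype.val hp.1
          have h2 := congrArg Subtype.val hp.2
          simp only [edge₁₂, edge₂₃] at h1 h2
          simp [h1, h2]
        · rintro ⟨⟨x, y, z⟩, hp⟩ _ ⟨⟨x', y', z'⟩, hp'⟩ _ h
          simp at h
          simp [h]
    _ ≤ 2 * 2 := by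
        rw [Finset.card_product]
        exact Nat.mul_le_mul (card_filter_sym2_mk_le _) (card_filter_sym2_mk_le _)

/-- The vertices of a triangle can be numbered so that its edges come in a prescribed order. -/
theorem exists_increasing {α : Type*} [LinearOrder α] (g : CompleteEdge n → α)
    (hg : Function.Injective g) :
    ∃ q : DistinctTriple n, g q.edge₁₂ < g q.edge₂₃ ∧ g q.edge₂₃ < g q.edge₁₃ ∧
      ∀ e, (e = q.edge₁₂ ∨ e = q.edge₂₃ ∨ e = q.edge₁₃) →
        (e = p.edge₁₂ ∨ e = p.edge₂₃ ∨ e = p.edge₁₃) := by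
  obtain ⟨⟨x, y, z⟩, hxy, hyz, hxz⟩ := p
  simp only at hxy hyz hxz
  set p : DistinctTriple n := ⟨⟨x, y, z⟩, hxy, hyz, hxz⟩
  have key : ∀ q : DistinctTriple n, ∀ a b c : CompleteEdge n,
      a = q.edge₁₂ → b = q.edge₂₃ → c = q.edge₁₃ →
      ((a = p.edge₁₂ ∨ a = p.edge₂₃ ∨ a = p.edge₁₃) ∧ (b = p.edge₁₂ ∨ b = p.edge₂₃ ∨ b = p.edge₁₃)
        ∧ (c = p.edge₁₂ ∨ c = p.edge₂₃ ∨ c = p.edge₁₃)) → g a < g b → g b < g c →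
    ∃ q : DistinctTriple n, g q.edge₁₂ < g q.edge₂₃ ∧ g q.edge₂₃ < g q.edge₁₃ ∧
      ∀ e, (e = q.edge₁₂ ∨ e = q.edge₂₃ ∨ e = q.edge₁₃) →
        (e = p.edge₁₂ ∨ e = p.edge₂₃ ∨ e = p.edge₁₃) := by
    rintro q a b c rfl rfl rfl h hab hbc
    refine ⟨q, hab, hbc, ?_⟩
    rintro e (rfl | rfl | rfl)
    exacts [h.1, h.2.1, h.2.2]
  have s1 : s(y, x) = s(x, y) := Sym2.eq_swap
  have s2 : s(z, y) = s(y, z) := Sym2.eq_swap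
  have s3 : s(z, x) = s(x, z) := Sym2.eq_swap
  have n1 : g p.edge₁₂ ≠ g p.edge₂₃ := fun h => by
    have := congrArg Subtype.val (hg h)
    simp [edge₁₂, edge₂₃, p] at this; tauto
  have n2 : g p.edge₁₂ ≠ g p.edge₁₃ := fun h => by
    have := congrArg Subtype.val (hg h)
    simp [edge₁₂, edge₁₃, p] at this; tauto
  have n3 : g p.edge₂₃ ≠ g p.edge₁₃ := fun h => by
    have := congrArg Subtype.val (hg h)
    simp [edge₂₃, edge₁₃, p] at this; tauto
  -- Of the eight sign patterns, six are the orders of the three edges, each realised by a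
  -- renumbering of the vertices; the other two are cyclic.
  rcases lt_or_gt_of_ne n1 with h1 | h1 <;> rcases lt_or_gt_of_ne n2 with h2 | h2 <;>
    rcases lt_or_gt_of_ne n3 with h3 | h3
  · exact key p p.edge₁₂ p.edge₂₃ p.edge₁₃ rfl rfl rfl (by simp) h1 h3
  · exact key ⟨⟨y, x, z⟩, hxy.symm, hxz, hyz⟩ p.edge₁₂ p.edge₁₃ p.edge₂₃
      (Subtype.ext s1.symm) rfl rfl (by simp) h2 h3
  · exact absurd (h1.trans h3) (not_lt_of_gt h2)
  · exact key ⟨⟨z, x, y⟩, hxz.symm, hxy, hyz.symm⟩ p.edge₁₃ p.edge₁₂ p.edge₂₃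
      (Subtype.ext s3.symm) rfl (Subtype.ext s2.symm) (by simp) h2 h1
  · exact key ⟨⟨z, y, x⟩, hyz.symm, hxy.symm, hxz.symm⟩ p.edge₂₃ p.edge₁₂ p.edge₁₃
      (Subtype.ext s2.symm) (Subtype.ext s1.symm) (Subtype.ext s3.symm) (by simp) h1 h2
  · exact absurd (h1.trans h2) (not_lt_of_gt h3)
  · exact key ⟨⟨y, z, x⟩, hyz, hxz.symm, hxy.symm⟩ p.edge₂₃ p.edge₁₃ p.edge₁₂
      rfl (Subtype.ext s3.symm) (Subtype.ext s1.symm) (by simp) h3 h2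
  · exact key ⟨⟨x, z, y⟩, hxz, hyz.symm, hxy⟩ p.edge₁₃ p.edge₂₃ p.edge₁₂
      rfl (Subtype.ext s2.symm) rfl (by simp) h3 h1

end DistinctTriple

namespace Strategy

variable {n t b : ℕ}

/-- Only one triangle of the fan is used, so the bound does not depend on k. With the vertices
numbered by order of arrival, the first two edges form an ordered pair of bought edges and the third
must still arrive before time t. -/
theorem successCount_triangleFan_mul_choose_le (σ : Strategy n t b) (ht : t ≤ n.choose 2) {k : ℕ}
    (hk : 1 ≤ k) :
    σ.successCount (triangleFan k) * n.choose 2 ≤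
      4 * b ^ 2 * t * Fintype.card (EdgeOrder n) := by
  classical
  let A : DistinctTriple n × Fin (n.choose 2) × Fin (n.choose 2) →
      Finset (EdgeOrder n) := fun x => Finset.univ.filter fun π =>
    (x.2.1 < x.2.2) ∧ (x.2.1 ∈ σ.boughtPos π t ∧ x.2.2 ∈ σ.boughtPos π t) ∧
      π x.2.1 = x.1.edge₁₂ ∧ π x.2.2 = x.1.edge₂₃
  have hcover : (Finset.univ.filter fun π : EdgeOrder n =>
      (triangleFan k).IsContained (σ.graphAt π t)) ⊆ Finset.univ.biUnion fun x =>
        (A x).filter fun π => ∀ e ∈ ({x.1.edge₁₃} : Finset (CompleteEdge n)),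
          x.2.2 < π.symm e ∧ (π.symm e : ℕ) < t := by
    intro π hπ
    obtain ⟨φ⟩ := (Finset.mem_filter.1 hπ).2
    let u : Option (Fin k × Bool) := none
    let v : Option (Fin k × Bool) := some (⟨0, hk⟩, false)
    let w : Option (Fin k × Bool) := some (⟨0, hk⟩, true)
    have huv : (triangleFan k).Adj u v := trivial
    have huw : (triangleFan k).Adj u w := trivial
    have hvw : (triangleFan k).Adj v w := ⟨rfl, by simp⟩
    let p : DistinctTriple n := ⟨(φ u, φ v, φ w), (φ.toHom.map_adj huv).ne,
      (φ.toHom.map_adj hvw).ne, (φ.toHom.map_adj huw).ne⟩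
    obtain ⟨q, h12, h23, hq⟩ := p.exists_increasing π.symm π.symm.injective
    have hp : ∀ e, (e = p.edge₁₂ ∨ e = p.edge₂₃ ∨ e = p.edge₁₃) →
        π.symm e ∈ σ.boughtPos π t := by
      rintro e (rfl | rfl | rfl) <;> rw [← mem_bought_iff]
      · exact (σ.graphAt_adj π t _ rfl).1 (φ.toHom.map_adj huv)
      · exact (σ.graphAt_adj π t _ rfl).1 (φ.toHom.map_adj hvw)
      · exact (σ.graphAt_adj π t _ rfl).1 (φ.toHom.map_adj huw)
    refine Finset.mem_biUnion.2 ⟨(q, π.symm q.edge₁₂, π.symm q.edge₂₃), Finset.mem_univ _, ?_⟩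
    refine Finset.mem_filter.2 ⟨Finset.mem_filter.2 ⟨Finset.mem_univ _, h12,
      ⟨hp _ (hq _ (.inl rfl)), hp _ (hq _ (.inr (.inl rfl)))⟩, by simp⟩, ?_⟩
    intro e he
    rw [Finset.mem_singleton.1 he]
    exact ⟨h23, (mem_boughtPos.1 (hp _ (hq _ (.inr (.inr rfl))))).1⟩
  have hA : ∀ x, ((A x).filter fun π => ∀ e ∈ ({x.1.edge₁₃} : Finset (CompleteEdge n)),
      x.2.2 < π.symm e ∧ (π.symm e : ℕ) < t).card * n.choose 2 ≤ t * (A x).card := by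
    intro x
    have := EdgeOrder.card_later_before_mul_le ht x.2.2 (A x) ?_ {x.1.edge₁₃}
    · simpa only [Finset.card_singleton, pow_one] using this
    intro π π' h hπ
    simp only [A, Finset.mem_filter, Finset.mem_univ, true_and, mem_boughtPos] at hπ ⊢
    -- The second edge is the later one, so agreement up to its position also determines the first
    -- purchase.
    have h' : ∀ j, j ≤ x.2.1 → π j = π' j := fun j hj => h j (hj.trans hπ.1.le)
    rwa [← σ.buy_congr h, ← σ.buy_congr h', ← h _ le_rfl, ← h' _ le_rfl]
  have hsum : ∑ x, (A x).card ≤ 4 * b ^ 2 * Fintype.card (EdgeOrder n) := by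
    calc ∑ x, (A x).card
        ≤ ∑ π : EdgeOrder n, ∑ y ∈ σ.boughtPos π t ×ˢ σ.boughtPos π t,
            (Finset.univ.filter fun p : DistinctTriple n =>
              p.edge₁₂ = π y.1 ∧ p.edge₂₃ = π y.2).card := by
          simp only [A, Finset.card_filter]
          rw [Finset.sum_comm]
          refine Finset.sum_le_sum fun π _ => ?_
          rw [Fintype.sum_prod_type, Finset.sum_comm,
            ← Finset.sum_subset (Finset.subset_univ (σ.boughtPos π t ×ˢ σ.boughtPos π t))]
          · refine Finset.sum_le_sum fun y _ => Finset.sum_le_sum fun p _ => ?_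
            split_ifs with h1 h2 <;> simp_all
          · intro y _ hy
            rw [Finset.mem_product] at hy
            simp [hy]
      _ ≤ ∑ π : EdgeOrder n, ∑ y ∈ σ.boughtPos π t ×ˢ σ.boughtPos π t, 4 := by
          exact Finset.sum_le_sum fun π _ => Finset.sum_le_sum fun y _ =>
            DistinctTriple.card_filter_edge_le _ _
      _ ≤ ∑ π : EdgeOrder n, b * b * 4 := by
          refine Finset.sum_le_sum fun π _ => ?_
          rw [Finset.sum_const, smul_eq_mul, Finset.card_product]
          exact Nat.mul_le_mul_right _
            (Nat.mul_le_mul (σ.card_boughtPos_le π) (σ.card_boughtPos_le π))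
      _ = _ := by
          simp only [Finset.sum_const, smul_eq_mul, Finset.card_univ]; ring
  calc σ.successCount (triangleFan k) * n.choose 2
      ≤ (∑ x, ((A x).filter fun π => ∀ e ∈ ({x.1.edge₁₃} : Finset (CompleteEdge n)),
          x.2.2 < π.symm e ∧ (π.symm e : ℕ) < t).card) * n.choose 2 :=
        Nat.mul_le_mul_right _ ((Finset.card_le_card hcover).trans Finset.card_biUnion_le)
    _ ≤ ∑ x, t * (A x).card := by
        rw [Finset.sum_mul]; exact Finset.sum_le_sum fun x _ => hA x
    _ ≤ _ := by
        rw [← Finset.mul_sum]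
        refine (Nat.mul_le_mul_left _ hsum).trans_eq (by ring)

end Strategy

end FirstMoment

/-! ### Rules based on the current graph, with a budget cap. -/

section GraphRule

variable {n : ℕ}

/-- The edges purchased from a sequence of presented edges by a rule that takes into account only
the time, the set of edges purchased so far and the edge presented now. -/
def boughtSeq (R : ℕ → Set (CompleteEdge n) → CompleteEdge n → Prop) :
    (s : ℕ) → (Fin s → CompleteEdge n) → Set (CompleteEdge n)
  | 0, _ => ∅
  | s + 1, f => boughtSeq R s (f ∘ Fin.castSucc) ∪
      {e | e = f (Fin.last s) ∧ R s (boughtSeq R s (f ∘ Fin.castSucc)) e}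

/-- The online decision rule that applies `R` to the current set of purchased edges. -/
def DecisionRule.ofRule (R : ℕ → Set (CompleteEdge n) → CompleteEdge n → Prop) : DecisionRule n :=
  fun i past e => R i (boughtSeq R i past) e

theorem DecisionRule.bought_zero (buy : DecisionRule n) (π : EdgeOrder n) :
    buy.bought π 0 = ∅ := by
  simp [DecisionRule.bought]

theorem DecisionRule.bought_succ (buy : DecisionRule n) (π : EdgeOrder n) {s : ℕ}
    (hs : s < n.choose 2) :
    buy.bought π (s + 1) =
      buy.bought π s ∪ {e | e = π ⟨s, hs⟩ ∧ buy ⟨s, hs⟩ (π.past ⟨s, hs⟩) e} := by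
  ext e
  simp only [DecisionRule.bought, Set.mem_union, Set.mem_ofPred_eq]
  constructor
  · rintro ⟨i, hi, h, rfl⟩
    rcases Nat.lt_succ_iff_lt_or_eq.1 hi with h' | h'
    · exact .inl ⟨i, h', h, rfl⟩
    · obtain rfl : i = ⟨s, hs⟩ := Fin.ext h'
      exact .inr ⟨rfl, h⟩
  · rintro (⟨i, hi, h, rfl⟩ | ⟨rfl, h⟩)
    · exact ⟨i, hi.trans (Nat.lt_succ_self _), h, rfl⟩
    · exact ⟨⟨s, hs⟩, Nat.lt_succ_self _, h, rfl⟩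

theorem DecisionRule.bought_succ_of_le (buy : DecisionRule n) (π : EdgeOrder n) {s : ℕ}
    (hs : n.choose 2 ≤ s) : buy.bought π (s + 1) = buy.bought π s := by
  ext e
  constructor
  · rintro ⟨i, -, h⟩; exact ⟨i, i.2.trans_le hs, h⟩
  · rintro ⟨i, hi, h⟩; exact ⟨i, hi.trans (Nat.lt_succ_self _), h⟩

/-- A decision rule sees only the past edges, and `boughtSeq` replays the purchases from them. The
replay agrees with the actual purchases, so `R` really acts on the current purchased set. -/
theorem DecisionRule.bought_ofRule (R : ℕ → Set (CompleteEdge n) → CompleteEdge n → Prop)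
    (π : EdgeOrder n) (s : ℕ) (hs : s ≤ n.choose 2) :
    (DecisionRule.ofRule R).bought π s = boughtSeq R s fun j => π (Fin.castLE hs j) := by
  induction s with
  | zero => rw [DecisionRule.bought_zero]; rfl
  | succ s ih =>
    rw [DecisionRule.bought_succ _ _ (Nat.lt_of_succ_le hs), ih (Nat.le_of_succ_le hs)]
    rfl

theorem DecisionRule.ofRule_iff (R : ℕ → Set (CompleteEdge n) → CompleteEdge n → Prop)
    (π : EdgeOrder n) (i : Fin (n.choose 2)) (e : CompleteEdge n) :
    DecisionRule.ofRule R i (π.past i) e ↔ R i ((DecisionRule.ofRule R).bought π i) e := by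
  rw [DecisionRule.bought_ofRule _ _ _ i.2.le]
  rfl

/-- Restrict a rule so that it never purchases more than `b` edges. -/
def cappedRule (b : ℕ) (R : ℕ → Set (CompleteEdge n) → CompleteEdge n → Prop) :
    ℕ → Set (CompleteEdge n) → CompleteEdge n → Prop :=
  fun s S e => S.ncard < b ∧ R s S e

namespace Strategy

/-- The `(t, b)`-strategy that applies `R` as long as the budget permits. -/
def ofRule (t b : ℕ) (R : ℕ → Set (CompleteEdge n) → CompleteEdge n → Prop) : Strategy n t b where
  buy := DecisionRule.ofRule (cappedRule b R)
  budget := by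
    intro π
    induction t with
    | zero => simp [DecisionRule.bought_zero]
    | succ s ih =>
      rcases Nat.lt_or_ge s (n.choose 2) with hs | hs
      · rw [DecisionRule.bought_succ _ _ hs]
        by_cases h : ((DecisionRule.ofRule (cappedRule b R)).bought π s).ncard < b
        · refine (Set.ncard_union_le _ _).trans (le_trans ?_ (Nat.succ_le_of_lt h))
          refine Nat.add_le_add_left ((Set.ncard_le_ncard (t := {π ⟨s, hs⟩}) ?_
            (Set.finite_singleton _)).trans_eq (Set.ncard_singleton _)) _
          exact fun e he => he.1
        · have : {e | e = π ⟨s, hs⟩ ∧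
              DecisionRule.ofRule (cappedRule b R) ⟨s, hs⟩ (π.past ⟨s, hs⟩) e} = ∅ := by
            rw [Set.eq_empty_iff_forall_notMem]
            rintro e ⟨-, he⟩
            exact h ((DecisionRule.ofRule_iff _ _ _ _).1 he).1
          rw [this, Set.union_empty]
          exact ih
      · rw [DecisionRule.bought_succ_of_le _ _ hs]
        exact ih

variable {t b : ℕ}

theorem ofRule_buy_iff (R : ℕ → Set (CompleteEdge n) → CompleteEdge n → Prop) (π : EdgeOrder n)
    (i : Fin (n.choose 2)) :
    (ofRule t b R).buy i (π.past i) (π i) ↔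
      ((ofRule t b R).buy.bought π i).ncard < b ∧ R i ((ofRule t b R).buy.bought π i) (π i) :=
  DecisionRule.ofRule_iff (cappedRule b R) π i (π i)

theorem bought_eq_of_graphAt_eq {σ : Strategy n t b} {π π' : EdgeOrder n} {s : ℕ}
    (h : σ.graphAt π s = σ.graphAt π' s) : σ.buy.bought π s = σ.buy.bought π' s := by
  ext e
  induction he : e.1 with
  | _ x y =>
  rw [← σ.graphAt_adj π s e he, ← σ.graphAt_adj π' s e he, h]

/-- The rule uses the history only through the purchased set, which can be read off from the graph.
-/
theorem isGraphBased_ofRule (R : ℕ → Set (CompleteEdge n) → CompleteEdge n → Prop) :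
    (ofRule t b R).IsGraphBased := by
  intro π π' i _ h h'
  rw [ofRule_buy_iff, ofRule_buy_iff, bought_eq_of_graphAt_eq h, h']

/-- If all purchases come from a set of at most `b` edges, the cap is never effective on it. -/
theorem mem_bought_ofRule {R : ℕ → Set (CompleteEdge n) → CompleteEdge n → Prop} {π : EdgeOrder n}
    {C : Set (CompleteEdge n)} (hC : ∀ s, (ofRule t b R).buy.bought π s ⊆ C) (hCb : C.ncard ≤ b)
    {s : ℕ} {e : CompleteEdge n} (heC : e ∈ C) (hs : (π.symm e : ℕ) < s)
    (hR : R (π.symm e) ((ofRule t b R).buy.bought π (π.symm e)) e) :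
    e ∈ (ofRule t b R).buy.bought π s := by
  rw [mem_bought_iff, mem_boughtPos, ofRule_buy_iff]
  -- At its own time `e` lies in `C` but is not yet bought, so the purchased set is a proper subset
  -- of `C` and the cap is not reached.
  refine ⟨hs, lt_of_lt_of_le (Set.ncard_lt_ncard ?_ (Set.toFinite _)) hCb, by simpa using hR⟩
  refine ⟨hC _, fun h => ?_⟩
  have := mem_boughtPos.1 (mem_bought_iff.1 (h heC))
  omega

end Strategy

end GraphRule

/-! ### The two-phase strategy. -/

section FanStrategy

variable {k m n r : ℕ}

/-- The edge from the `v`-th centre to the `a`-th vertex of the class `(i, β)` of leaves. -/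
def starEdge (emb : Fin r ⊕ (Fin k × Bool × Fin m) ↪ Fin n) (v : Fin r)
    (x : Fin k × Bool × Fin m) : CompleteEdge n :=
  ⟨s(emb (.inl v), emb (.inr x)), by simp⟩

/-- The edge from the `a`-th vertex of the class `(i, false)` to the `a'`-th vertex of the class
`(i, true)` of leaves. -/
def chordEdge (emb : Fin r ⊕ (Fin k × Bool × Fin m) ↪ Fin n) (i : Fin k) (y : Fin m × Fin m) :
    CompleteEdge n :=
  ⟨s(emb (.inr (i, false, y.1)), emb (.inr (i, true, y.2))), by simp⟩

variable (emb : Fin r ⊕ (Fin k × Bool × Fin m) ↪ Fin n)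

theorem starEdge_inj {v v' : Fin r} {x x' : Fin k × Bool × Fin m} :
    starEdge emb v x = starEdge emb v' x' ↔ v = v' ∧ x = x' := by
  simp [starEdge]

theorem chordEdge_inj {i i' : Fin k} {y y' : Fin m × Fin m} :
    chordEdge emb i y = chordEdge emb i' y' ↔ i = i' ∧ y = y' := by
  simp [chordEdge, Prod.ext_iff]; tauto

theorem starEdge_ne_chordEdge (v : Fin r) (x : Fin k × Bool × Fin m) (i : Fin k)
    (y : Fin m × Fin m) : starEdge emb v x ≠ chordEdge emb i y := by
  simp [starEdge, chordEdge]

/-- First purchase the edges between centres and leaves, during `w₁` steps, then, during `w₂` steps,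
the chords that form a triangle with two purchased edges at a centre. -/
def fanRule (w₁ w₂ : ℕ) (p : ℕ) (S : Set (CompleteEdge n)) (e : CompleteEdge n) : Prop :=
  (p < w₁ ∧ ∃ v x, e = starEdge emb v x) ∨
  ((w₁ ≤ p ∧ p < w₁ + w₂) ∧ ∃ v i y, e = chordEdge emb i y ∧
    starEdge emb v (i, false, y.1) ∈ S ∧ starEdge emb v (i, true, y.2) ∈ S)

/-- The triangle at the centre `v` spanned by the chord `(i, y)` is presented as required by the
strategy. -/
def TriangleTimely (w₁ w₂ : ℕ) (π : EdgeOrder n) (v : Fin r) (i : Fin k) (y : Fin m × Fin m) :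
    Prop :=
  ((π.symm (starEdge emb v (i, false, y.1)) : ℕ) < w₁ ∧
    (π.symm (starEdge emb v (i, true, y.2)) : ℕ) < w₁) ∧
    (w₁ ≤ (π.symm (chordEdge emb i y) : ℕ) ∧ (π.symm (chordEdge emb i y) : ℕ) < w₁ + w₂)

open Classical in
/-- An upper bound for the number of edges that the strategy wants to purchase. -/
noncomputable def fanCost (w₁ w₂ : ℕ) (π : EdgeOrder n) : ℕ :=
  (Finset.univ.filter fun z : Fin r × Fin k × Bool × Fin m =>
    (π.symm (starEdge emb z.1 z.2) : ℕ) < w₁).card +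
  (Finset.univ.filter fun z : Fin r × Fin k × Fin m × Fin m =>
    TriangleTimely emb w₁ w₂ π z.1 z.2.1 z.2.2).card

/-- The deterministic core. All purchases lie in the set `C` of timely star edges and chords of
timely triangles, whose size is at most `fanCost`. If the budget covers this cost, the cap never
acts and every timely fan is bought completely. -/
theorem isContained_graphAt_ofRule {w₁ w₂ t b : ℕ} (hw : w₁ + w₂ ≤ t) (π : EdgeOrder n)
    (hcost : fanCost emb w₁ w₂ π ≤ b) (v : Fin r) (y : Fin k → Fin m × Fin m)
    (hy : ∀ i, TriangleTimely emb w₁ w₂ π v i (y i)) :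
    (triangleFan k).IsContained
      ((Strategy.ofRule t b (fanRule emb w₁ w₂)).graphAt π t) := by
  classical
  set σ := Strategy.ofRule t b (fanRule emb w₁ w₂)
  let C₁ : Finset (CompleteEdge n) := (Finset.univ.filter fun z : Fin r × Fin k × Bool × Fin m =>
    (π.symm (starEdge emb z.1 z.2) : ℕ) < w₁).image fun z => starEdge emb z.1 z.2
  let C₂ : Finset (CompleteEdge n) := (Finset.univ.filter fun z : Fin r × Fin k × Fin m × Fin m =>
    TriangleTimely emb w₁ w₂ π z.1 z.2.1 z.2.2).image fun z => chordEdge emb z.2.1 z.2.2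
  let C : Finset (CompleteEdge n) := C₁ ∪ C₂
  have hCb : (C : Set (CompleteEdge n)).ncard ≤ b := by
    rw [Set.ncard_coe_finset]
    exact ((Finset.card_union_le _ _).trans
      (Nat.add_le_add Finset.card_image_le Finset.card_image_le)).trans hcost
  have hC₁ : ∀ v x, starEdge emb v x ∈ C ↔ (π.symm (starEdge emb v x) : ℕ) < w₁ := by
    intro v x
    simp only [C, C₁, C₂, Finset.mem_union, Finset.mem_image, Finset.mem_filter, Finset.mem_univ,
      true_and]
    constructor
    · rintro (⟨z, hz, h⟩ | ⟨z, -, h⟩)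
      · rwa [← h]
      · exact absurd h.symm (starEdge_ne_chordEdge _ _ _ _ _)
    · exact fun h => .inl ⟨(v, x), h, rfl⟩
  have hC₂ : ∀ v i y, TriangleTimely emb w₁ w₂ π v i y → chordEdge emb i y ∈ C := by
    intro v i y h
    exact Finset.mem_union_right _ (Finset.mem_image.2 ⟨(v, i, y), by simpa using h, rfl⟩)
  have hsub : ∀ s, σ.buy.bought π s ⊆ C := by
    -- A chord is bought only if two star edges at a common centre were bought before it; by
    -- induction these were timely, hence so is the triangle.
    intro s
    induction s using Nat.strong_induction_on with
    | _ s ih =>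
    rintro _ ⟨i, his, hi, rfl⟩
    obtain ⟨-, hi⟩ := (Strategy.ofRule_buy_iff _ _ _).1 hi
    rcases hi with ⟨h, v, x, he⟩ | ⟨h, v, i', y, he, h1, h2⟩
    · have h3 : π.symm (starEdge emb v x) = i := by rw [← he, Equiv.symm_apply_apply]
      rw [he, Finset.mem_coe, hC₁, h3]
      exact h
    · have h3 : π.symm (chordEdge emb i' y) = i := by rw [← he, Equiv.symm_apply_apply]
      rw [he]
      refine hC₂ v i' y ⟨⟨(hC₁ _ _).1 (ih i his h1), (hC₁ _ _).1 (ih i his h2)⟩, ?_⟩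
      rw [h3]
      exact h
  have hstar : ∀ v x s, (π.symm (starEdge emb v x) : ℕ) < w₁ →
      (π.symm (starEdge emb v x) : ℕ) < s → starEdge emb v x ∈ σ.buy.bought π s := fun v x s h h' =>
    Strategy.mem_bought_ofRule hsub hCb ((hC₁ v x).2 h) h' (.inl ⟨h, v, x, rfl⟩)
  have hb : ∀ i, (starEdge emb v (i, false, (y i).1) ∈ σ.buy.bought π t ∧
      starEdge emb v (i, true, (y i).2) ∈ σ.buy.bought π t) ∧
      chordEdge emb i (y i) ∈ σ.buy.bought π t := by
    intro i
    obtain ⟨⟨h1, h2⟩, h3⟩ := hy i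
    refine ⟨⟨hstar _ _ _ h1 (by omega), hstar _ _ _ h2 (by omega)⟩, ?_⟩
    exact Strategy.mem_bought_ofRule hsub hCb (hC₂ v i (y i) (hy i)) (by omega)
      (.inr ⟨h3, v, i, y i, rfl, hstar _ _ _ h1 (by omega), hstar _ _ _ h2 (by omega)⟩)
  let g : Fin k × Bool → Fin m := fun x => if x.2 then (y x.1).2 else (y x.1).1
  let φ : Option (Fin k × Bool) → Fin n := fun u =>
    u.elim (emb (.inl v)) fun x => emb (.inr (x.1, x.2, g x))
  have hstar' : ∀ x : Fin k × Bool, (σ.graphAt π t).Adj (emb (.inl v)) (emb (.inr (x.1, x.2, g x))) := by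
    rintro ⟨i, _ | _⟩
    · exact (σ.graphAt_adj π t _ rfl).2 (hb i).1.1
    · exact (σ.graphAt_adj π t _ rfl).2 (hb i).1.2
  have hadj : ∀ u w, (triangleFan k).Adj u w → (σ.graphAt π t).Adj (φ u) (φ w) := by
    rintro (_ | x) (_ | x') h
    · exact h.elim
    · exact hstar' x'
    · exact (hstar' x).symm
    · obtain ⟨i, β⟩ := x
      obtain ⟨i', γ⟩ := x'
      obtain ⟨h1, h2⟩ : i = i' ∧ β ≠ γ := h
      subst h1
      have hc : (σ.graphAt π t).Adj (φ (some (i, false))) (φ (some (i, true))) :=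
        (σ.graphAt_adj π t _ rfl).2 (hb i).2
      cases β <;> cases γ
      · exact absurd rfl h2
      · exact hc
      · exact hc.symm
      · exact absurd rfl h2
  refine ⟨⟨⟨φ, fun {u w} h => hadj u w h⟩, ?_⟩⟩
  rintro (_ | ⟨i, β⟩) (_ | ⟨i', γ⟩) h
  · rfl
  · exact absurd (emb.injective h) (by simp)
  · exact absurd (emb.injective h) (by simp)
  · have := emb.injective h
    simp only [Sum.inr.injEq, Prod.mk.injEq] at this
    rw [this.1, this.2.1]

end FanStrategy

/-! ### Probabilities of arrival in prescribed time windows. -/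

section WindowProbability

variable {n : ℕ}

/-- `c` is the number of orders that put `F` at any given distinct positions, so window
probabilities reduce to counting injections. -/
theorem EdgeOrder.exists_card_window {ι : Type*} [Fintype ι] (F : ι ↪ CompleteEdge n) :
    ∃ c : ℕ, c * (n.choose 2).descFactorial (Fintype.card ι) = Fintype.card (EdgeOrder n) ∧
      ∀ W : ι → Finset (Fin (n.choose 2)),
        (Finset.univ.filter fun π : EdgeOrder n => ∀ j, π.symm (F j) ∈ W j).card =
          c * (Finset.univ.filter fun q : ι ↪ Fin (n.choose 2) => ∀ j, q j ∈ W j).card := by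
  classical
  obtain ⟨c, hc⟩ := exists_card_filter_symm_mem (Finset.univ : Finset (EdgeOrder n)) Finset.univ
    (fun _ _ _ _ => Finset.mem_univ _) F
  refine ⟨c, ?_, fun W => hc W fun _ => Finset.subset_univ _⟩
  have := hc (fun _ => Finset.univ) fun _ => Finset.subset_univ _
  rw [card_filter_embedding_mem] at this
  simpa [eq_comm] using this

/-- The probability that each of several edges arrives in its time window is at most about the
product of the individual probabilities. -/
theorem EdgeOrder.card_window_le (F : Finset (CompleteEdge n))
    (W : CompleteEdge n → Finset (Fin (n.choose 2))) {M : ℝ} (hM : 0 < M)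
    (hMF : M + F.card ≤ n.choose 2 + 1) :
    ((Finset.univ.filter fun π : EdgeOrder n => ∀ e ∈ F, π.symm e ∈ W e).card : ℝ) ≤
      Fintype.card (EdgeOrder n) * ∏ e ∈ F, ((W e).card / M) := by
  classical
  obtain ⟨c, hcT, hc⟩ := EdgeOrder.exists_card_window (Function.Embedding.subtype (· ∈ F))
  have h1 : (Finset.univ.filter fun π : EdgeOrder n => ∀ e ∈ F, π.symm e ∈ W e).card ≤
      c * ∏ e ∈ F, (W e).card := by
    have h2 := hc fun j => W j
    have h3 : (Finset.univ.filter fun π : EdgeOrder n => ∀ e ∈ F, π.symm e ∈ W e) =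
        Finset.univ.filter fun π : EdgeOrder n =>
          ∀ j : F, π.symm (Function.Embedding.subtype (· ∈ F) j) ∈ W j := by
      ext π; simp
    rw [h3, h2, ← Finset.prod_coe_sort, ← Fintype.card_piFinset]
    refine Nat.mul_le_mul_left _ (Finset.card_le_card_of_injOn (fun q j => q j) ?_ ?_)
    · intro q hq
      simpa using hq
    · intro q _ q' _ h
      exact DFunLike.coe_injective h
  have h4 : (n.choose 2 + 1 - F.card) ^ F.card ≤ (n.choose 2).descFactorial F.card :=
    Nat.pow_sub_le_descFactorial _ _
  rw [Fintype.card_coe] at hcT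
  have h5 : F.card ≤ n.choose 2 + 1 := by
    have : (F.card : ℝ) ≤ ((n.choose 2 + 1 : ℕ) : ℝ) := by push_cast; linarith
    exact_mod_cast this
  -- `M` is at most `n.choose 2 + 1 - F.card`, the smallest factor of the descending factorial.
  have h6 : M ^ F.card ≤ (n.choose 2).descFactorial F.card := by
    refine le_trans ?_ (by exact_mod_cast h4 :
      (((n.choose 2 + 1 - F.card : ℕ) : ℝ)) ^ F.card ≤ _)
    gcongr
    rw [Nat.cast_sub h5]; push_cast; linarith
  rw [Finset.prod_div_distrib, Finset.prod_const, ← mul_div_assoc, le_div_iff₀ (by positivity)]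
  calc _ ≤ ((c : ℝ) * ∏ e ∈ F, ((W e).card : ℝ)) * (n.choose 2).descFactorial F.card := by
        gcongr
        exact_mod_cast h1
    _ = ((c : ℝ) * (n.choose 2).descFactorial F.card) * ∏ e ∈ F, ((W e).card : ℝ) := by ring
    _ = _ := by
        rw [← hcT]; push_cast; ring

/-- As the windows are disjoint, an injection into each glues to one injection of positions; the
total number of injections is bounded by a plain power. -/
theorem EdgeOrder.le_card_window {ι₁ ι₂ : Type*} [Fintype ι₁] [Fintype ι₂]
    (F : ι₁ ⊕ ι₂ ↪ CompleteEdge n) (W₁ W₂ : Finset (Fin (n.choose 2))) (hW : Disjoint W₁ W₂)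
    (hN : 0 < n.choose 2) :
    (Fintype.card (EdgeOrder n) : ℝ) * ((W₁.card.descFactorial (Fintype.card ι₁) : ℝ) *
      (W₂.card.descFactorial (Fintype.card ι₂) : ℝ) /
        (n.choose 2 : ℝ) ^ (Fintype.card ι₁ + Fintype.card ι₂)) ≤
      (Finset.univ.filter fun π : EdgeOrder n =>
        ∀ j, π.symm (F j) ∈ Sum.elim (fun _ => W₁) (fun _ => W₂) j).card := by
  classical
  obtain ⟨c, hcT, hc⟩ := EdgeOrder.exists_card_window F
  rw [hc]
  have h1 : W₁.card.descFactorial (Fintype.card ι₁) * W₂.card.descFactorial (Fintype.card ι₂) ≤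
      (Finset.univ.filter fun q : ι₁ ⊕ ι₂ ↪ Fin (n.choose 2) =>
        ∀ j, q j ∈ Sum.elim (fun _ => W₁) (fun _ => W₂) j).card := by
    rw [← Fintype.card_coe W₁, ← Fintype.card_coe W₂, ← Fintype.card_embedding_eq,
      ← Fintype.card_embedding_eq, ← Fintype.card_prod, ← Finset.card_univ]
    refine Finset.card_le_card_of_injOn (fun q => ⟨Sum.elim (fun j => (q.1 j : Fin (n.choose 2)))
      (fun j => (q.2 j : Fin (n.choose 2))), ?_⟩) ?_ ?_
    · refine Function.Injective.sumElim (Subtype.val_injective.comp q.1.injective)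
        (Subtype.val_injective.comp q.2.injective) fun a a' h => ?_
      exact Finset.disjoint_left.1 hW (q.1 a).2 (h ▸ (q.2 a').2)
    · intro q _
      simp only [Finset.coe_filter, Finset.mem_univ, true_and, Set.mem_ofPred_eq]
      rintro (j | j) <;> simp
    · intro q _ q' _ h
      have h' := DFunLike.congr_fun h
      refine Prod.ext (DFunLike.ext _ _ fun j => Subtype.ext (h' (.inl j)))
        (DFunLike.ext _ _ fun j => Subtype.ext (h' (.inr j)))
  have h2 : (Fintype.card (EdgeOrder n) : ℝ) ≤
      c * (n.choose 2 : ℝ) ^ (Fintype.card ι₁ + Fintype.card ι₂) := by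
    rw [← hcT, Fintype.card_sum]
    exact_mod_cast Nat.mul_le_mul_left c (Nat.descFactorial_le_pow _ _)
  rw [← mul_div_assoc, div_le_iff₀ (by positivity)]
  calc _ ≤ (c * (n.choose 2 : ℝ) ^ (Fintype.card ι₁ + Fintype.card ι₂)) *
        ((W₁.card.descFactorial (Fintype.card ι₁) * W₂.card.descFactorial (Fintype.card ι₂) : ℕ) : ℝ) := by
        push_cast; gcongr
    _ ≤ (c * (n.choose 2 : ℝ) ^ (Fintype.card ι₁ + Fintype.card ι₂)) *
        ((Finset.univ.filter fun q : ι₁ ⊕ ι₂ ↪ Fin (n.choose 2) =>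
        ∀ j, q j ∈ Sum.elim (fun _ => W₁) (fun _ => W₂) j).card : ℝ) := by
        gcongr
    _ = _ := by push_cast; ring

end WindowProbability

/-! ### Moments of the number of timely fans, and the expected cost. -/

/-- The second moment method for a counting function on a finite set. -/
theorem sq_sum_le_card_filter_pos_mul {α : Type*} (s : Finset α) (X : α → ℕ) :
    (∑ a ∈ s, (X a : ℝ)) ^ 2 ≤ ((s.filter fun a => 0 < X a).card : ℝ) * ∑ a ∈ s, (X a : ℝ) ^ 2 := by
  have h1 : ∑ a ∈ s, (X a : ℝ) = ∑ a ∈ s.filter (fun a => 0 < X a), 1 * (X a : ℝ) := by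
    rw [Finset.sum_filter]
    refine Finset.sum_congr rfl fun a _ => ?_
    split_ifs with h
    · ring
    · simp at h; simp [h]
  rw [h1]
  refine (Finset.sum_mul_sq_le_sq_mul_sq _ _ _).trans ?_
  simp only [one_pow, Finset.sum_const, nsmul_eq_mul, mul_one]
  gcongr
  exact Finset.filter_subset _ _

section FanMoments

variable {k m n r : ℕ} (emb : Fin r ⊕ (Fin k × Bool × Fin m) ↪ Fin n)

/-- The edges of the potential fan with centre `v` and chords `y`. -/
def fanPlan (z : Fin r × (Fin k → Fin m × Fin m)) : (Fin k × Bool) ⊕ Fin k → CompleteEdge n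
  | .inl (i, β) => starEdge emb z.1 (i, β, if β then (z.2 i).2 else (z.2 i).1)
  | .inr i => chordEdge emb i (z.2 i)

/-- Centres and leaf classes are disjoint, so an edge can play only one role. Overlaps of two
planned fans can therefore be examined role by role. -/
theorem fanPlan_eq_imp {z z' : Fin r × (Fin k → Fin m × Fin m)} {j j' : (Fin k × Bool) ⊕ Fin k}
    (h : fanPlan emb z j = fanPlan emb z' j') : j = j' := by
  rcases j with ⟨i, β⟩ | i <;> rcases j' with ⟨i', γ⟩ | i'
  · have := (starEdge_inj emb).1 h
    simp only [Prod.mk.injEq] at this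
    rw [this.2.1, this.2.2.1]
  · exact absurd h (starEdge_ne_chordEdge _ _ _ _ _)
  · exact absurd h.symm (starEdge_ne_chordEdge _ _ _ _ _)
  · rw [((chordEdge_inj emb).1 h).1]

theorem fanPlan_injective (z : Fin r × (Fin k → Fin m × Fin m)) :
    Function.Injective (fanPlan emb z) := fun _ _ h => fanPlan_eq_imp emb h

/-- The edges of a potential fan as a finite set. -/
def fanPlanEdges (z : Fin r × (Fin k → Fin m × Fin m)) : Finset (CompleteEdge n) :=
  Finset.univ.map ⟨fanPlan emb z, fanPlan_injective emb z⟩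

theorem card_fanPlanEdges (z : Fin r × (Fin k → Fin m × Fin m)) :
    (fanPlanEdges emb z).card = 3 * k := by
  rw [fanPlanEdges, Finset.card_map, Finset.card_univ]; simp; ring

/-- The positions below `w₁`. -/
def firstWindow (n w₁ : ℕ) : Finset (Fin (n.choose 2)) :=
  Finset.univ.filter fun p => (p : ℕ) < w₁

/-- The `w₂` positions from `w₁` on. -/
def secondWindow (n w₁ w₂ : ℕ) : Finset (Fin (n.choose 2)) :=
  Finset.univ.filter fun p => w₁ ≤ (p : ℕ) ∧ (p : ℕ) < w₁ + w₂

theorem card_firstWindow {n w₁ : ℕ} (h : w₁ ≤ n.choose 2) : (firstWindow n w₁).card = w₁ := by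
  rw [← Finset.card_map Fin.valEmbedding]
  conv_rhs => rw [← Finset.card_range w₁]
  congr 1
  ext a
  simp only [firstWindow, Finset.mem_map, Finset.mem_filter, Finset.mem_univ, true_and,
    Fin.valEmbedding_apply, Finset.mem_range]
  exact ⟨fun ⟨p, hp, h⟩ => h ▸ hp, fun ha => ⟨⟨a, ha.trans_le h⟩, ha, rfl⟩⟩

theorem card_secondWindow {n w₁ w₂ : ℕ} (h : w₁ + w₂ ≤ n.choose 2) :
    (secondWindow n w₁ w₂).card = w₂ := by
  rw [← Finset.card_map Fin.valEmbedding]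
  have : (Finset.Ico w₁ (w₁ + w₂)).card = w₂ := by simp
  conv_rhs => rw [← this]
  congr 1
  ext a
  simp only [secondWindow, Finset.mem_map, Finset.mem_filter, Finset.mem_univ, true_and,
    Fin.valEmbedding_apply, Finset.mem_Ico]
  exact ⟨fun ⟨p, hp, h⟩ => h ▸ hp, fun ha => ⟨⟨a, ha.2.trans_le h⟩, ha, rfl⟩⟩

theorem disjoint_windows (n w₁ w₂ : ℕ) : Disjoint (firstWindow n w₁) (secondWindow n w₁ w₂) := by
  rw [Finset.disjoint_left]
  intro p h h'
  simp only [firstWindow, secondWindow, Finset.mem_filter] at h h'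
  omega

open Classical in
/-- The window in which an edge is wanted. -/
noncomputable def edgeWindow (w₁ w₂ : ℕ) (e : CompleteEdge n) : Finset (Fin (n.choose 2)) :=
  if ∃ v x, e = starEdge emb v x then firstWindow n w₁ else secondWindow n w₁ w₂

theorem edgeWindow_star (w₁ w₂ : ℕ) (v : Fin r) (x : Fin k × Bool × Fin m) :
    edgeWindow emb w₁ w₂ (starEdge emb v x) = firstWindow n w₁ :=
  if_pos ⟨v, x, rfl⟩

theorem edgeWindow_chord (w₁ w₂ : ℕ) (i : Fin k) (y : Fin m × Fin m) :
    edgeWindow emb w₁ w₂ (chordEdge emb i y) = secondWindow n w₁ w₂ :=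
  if_neg fun ⟨_, _, h⟩ => starEdge_ne_chordEdge _ _ _ _ _ h.symm

theorem edgeWindow_fanPlan (w₁ w₂ : ℕ) (z : Fin r × (Fin k → Fin m × Fin m))
    (j : (Fin k × Bool) ⊕ Fin k) :
    edgeWindow emb w₁ w₂ (fanPlan emb z j) =
      Sum.elim (fun _ => firstWindow n w₁) (fun _ => secondWindow n w₁ w₂) j := by
  rcases j with ⟨i, β⟩ | i
  · exact edgeWindow_star _ _ _ _ _
  · exact edgeWindow_chord _ _ _ _ _

theorem forall_triangleTimely_iff (w₁ w₂ : ℕ) (π : EdgeOrder n)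
    (z : Fin r × (Fin k → Fin m × Fin m)) :
    (∀ i, TriangleTimely emb w₁ w₂ π z.1 i (z.2 i)) ↔
      ∀ e ∈ fanPlanEdges emb z, π.symm e ∈ edgeWindow emb w₁ w₂ e := by
  have : (∀ e ∈ fanPlanEdges emb z, π.symm e ∈ edgeWindow emb w₁ w₂ e) ↔
      ∀ j, π.symm (fanPlan emb z j) ∈
        Sum.elim (fun _ => firstWindow n w₁) (fun _ => secondWindow n w₁ w₂) j := by
    simp only [← edgeWindow_fanPlan emb w₁ w₂ z, fanPlanEdges, Finset.mem_map, Finset.mem_univ,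
      true_and, Function.Embedding.coeFn_mk, forall_exists_index, forall_apply_eq_imp_iff]
  rw [this]
  simp only [Sum.forall, Prod.forall, Bool.forall_bool, Sum.elim_inl, Sum.elim_inr, fanPlan,
    firstWindow, secondWindow, Finset.mem_filter, Finset.mem_univ, true_and, TriangleTimely,
    forall_and, if_true, Bool.false_eq_true, if_false]

open Classical in
/-- The number of fans of the prescribed kind that are presented as required. -/
noncomputable def fanCount (w₁ w₂ : ℕ) (π : EdgeOrder n) : ℕ :=
  (Finset.univ.filter fun z : Fin r × (Fin k → Fin m × Fin m) =>
    ∀ e ∈ fanPlanEdges emb z, π.symm e ∈ edgeWindow emb w₁ w₂ e).card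

theorem le_sum_fanCount {w₁ w₂ : ℕ} (hw : w₁ + w₂ ≤ n.choose 2) (hN : 0 < n.choose 2) :
    (Fintype.card (EdgeOrder n) : ℝ) * (r * (m : ℝ) ^ (2 * k) *
      ((w₁.descFactorial (2 * k) : ℝ) * w₂.descFactorial k / (n.choose 2 : ℝ) ^ (3 * k))) ≤
      ∑ π : EdgeOrder n, (fanCount emb w₁ w₂ π : ℝ) := by
  classical
  have h1 : ∑ π : EdgeOrder n, (fanCount emb w₁ w₂ π : ℝ) =
      ∑ z : Fin r × (Fin k → Fin m × Fin m), ((Finset.univ.filter fun π : EdgeOrder n =>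
        ∀ e ∈ fanPlanEdges emb z, π.symm e ∈ edgeWindow emb w₁ w₂ e).card : ℝ) := by
    simp only [fanCount, Finset.card_filter]
    push_cast
    exact Finset.sum_comm
  rw [h1]
  have h2 : ∀ z : Fin r × (Fin k → Fin m × Fin m), (Fintype.card (EdgeOrder n) : ℝ) *
      ((w₁.descFactorial (2 * k) : ℝ) * w₂.descFactorial k / (n.choose 2 : ℝ) ^ (3 * k)) ≤
      ((Finset.univ.filter fun π : EdgeOrder n =>
        ∀ e ∈ fanPlanEdges emb z, π.symm e ∈ edgeWindow emb w₁ w₂ e).card : ℝ) := by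
    intro z
    have h := EdgeOrder.le_card_window ⟨fanPlan emb z, fanPlan_injective emb z⟩
      (firstWindow n w₁) (secondWindow n w₁ w₂) (disjoint_windows n w₁ w₂) hN
    rw [card_firstWindow (by omega), card_secondWindow hw] at h
    have e1 : Fintype.card (Fin k × Bool) = 2 * k := by simp; ring
    have e2 : 2 * k + Fintype.card (Fin k) = 3 * k := by simp; ring
    rw [e1, e2, Fintype.card_fin] at h
    refine h.trans_eq ?_
    congr 2
    ext π
    simp only [Finset.mem_filter, Finset.mem_univ, true_and, Function.Embedding.coeFn_mk,
      ← edgeWindow_fanPlan emb w₁ w₂ z, fanPlanEdges, Finset.mem_map,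
      forall_exists_index, forall_apply_eq_imp_iff]
  refine le_trans (le_of_eq ?_) (Finset.sum_le_sum fun z _ => h2 z)
  rw [Finset.sum_const, Finset.card_univ, nsmul_eq_mul]
  simp only [Fintype.card_prod, Fintype.card_fin, Fintype.card_fun]
  push_cast
  ring

theorem prod_fanPlanEdges (w₁ w₂ : ℕ) (z : Fin r × (Fin k → Fin m × Fin m))
    (g : Finset (Fin (n.choose 2)) → ℝ) :
    ∏ e ∈ fanPlanEdges emb z, g (edgeWindow emb w₁ w₂ e) =
      (g (firstWindow n w₁) ^ 2 * g (secondWindow n w₁ w₂)) ^ k := by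
  rw [fanPlanEdges, Finset.prod_map]
  simp only [Function.Embedding.coeFn_mk, edgeWindow_fanPlan, Fintype.prod_sum_type, Sum.elim_inl,
    Sum.elim_inr, Finset.prod_const, Finset.card_univ, Fintype.card_prod, Fintype.card_fin,
    Fintype.card_bool]
  rw [mul_pow, ← pow_mul, mul_comm k 2]

/-- A common edge has the same role in both plans. Sharing a star edge requires the same centre and
leaf; sharing a chord does not involve the centres. -/
theorem prod_inter_fanPlanEdges (w₁ w₂ : ℕ) (z z' : Fin r × (Fin k → Fin m × Fin m))
    (g : Finset (Fin (n.choose 2)) → ℝ) :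
    ∏ e ∈ fanPlanEdges emb z ∩ fanPlanEdges emb z', g (edgeWindow emb w₁ w₂ e) =
      ∏ i, ((if z.1 = z'.1 ∧ (z.2 i).1 = (z'.2 i).1 then g (firstWindow n w₁) else 1) *
        (if z.1 = z'.1 ∧ (z.2 i).2 = (z'.2 i).2 then g (firstWindow n w₁) else 1) *
        (if z.2 i = z'.2 i then g (secondWindow n w₁ w₂) else 1)) := by
  classical
  have h1 : ∀ j, fanPlan emb z j ∈ fanPlanEdges emb z' ↔ fanPlan emb z j = fanPlan emb z' j := by
    intro j
    simp only [fanPlanEdges, Finset.mem_map, Finset.mem_univ, true_and,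
      Function.Embedding.coeFn_mk]
    constructor
    · rintro ⟨j', h⟩
      obtain rfl := fanPlan_eq_imp emb h
      exact h.symm
    · exact fun h => ⟨j, h.symm⟩
  rw [← Finset.filter_mem_eq_inter, Finset.prod_filter]
  conv_lhs => rw [fanPlanEdges, Finset.prod_map]
  simp only [Function.Embedding.coeFn_mk, h1, edgeWindow_fanPlan, Fintype.prod_sum_type,
    Sum.elim_inl, Sum.elim_inr, Fintype.prod_prod_type, Fintype.prod_bool]
  rw [← Finset.prod_mul_distrib]
  refine Finset.prod_congr rfl fun i _ => ?_
  simp only [fanPlan, starEdge_inj, chordEdge_inj, true_and, Prod.mk.injEq, if_true,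
    Bool.false_eq_true, if_false]
  ring

/-- The weight is at most the sum of one term for each way in which `x` can agree with `y`: not at
all, in one given coordinate, or in both. -/
theorem sum_overlap_weight_le {m : ℕ} (y : Fin m × Fin m) {A : ℝ} (B : ℝ) (hA : 0 ≤ A) :
    ∑ x : Fin m × Fin m, ((if y.1 = x.1 then A else 1) * (if y.2 = x.2 then A else 1) *
      (if y = x then B else 1)) ≤ (m : ℝ) ^ 2 + 2 * m * A + A ^ 2 * B := by
  calc _ ≤ ∑ x : Fin m × Fin m, (1 + (if y.1 = x.1 then A else 0) + (if y.2 = x.2 then A else 0) +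
        (if y = x then A ^ 2 * B else 0)) := by
        refine Finset.sum_le_sum fun x _ => ?_
        by_cases h1 : y.1 = x.1 <;> by_cases h2 : y.2 = x.2
        · have h3 : y = x := Prod.ext h1 h2
          simp only [h3, if_true]
          nlinarith
        · have h3 : y ≠ x := fun h => h2 (by rw [h])
          simp [h1, h2, h3]
        · have h3 : y ≠ x := fun h => h1 (by rw [h])
          simp [h1, h2, h3]
        · have h3 : y ≠ x := fun h => h1 (by rw [h])
          simp [h1, h2, h3]
    _ = _ := by
        have h1 : ∑ x : Fin m × Fin m, (if y.1 = x.1 then A else 0) = m * A := by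
          rw [Fintype.sum_prod_type_right]; simp
        have h2 : ∑ x : Fin m × Fin m, (if y.2 = x.2 then A else 0) = m * A := by
          rw [Fintype.sum_prod_type]; simp
        rw [Finset.sum_add_distrib, Finset.sum_add_distrib, Finset.sum_add_distrib, h1, h2,
          Finset.sum_ite_eq]
        simp
        ring

theorem sum_chord_weight_le {m : ℕ} (y : Fin m × Fin m) (B : ℝ) :
    ∑ x : Fin m × Fin m, (if y = x then B else 1) ≤ (m : ℝ) ^ 2 + B := by
  calc _ ≤ ∑ x : Fin m × Fin m, (1 + (if y = x then B else 0)) := by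
        refine Finset.sum_le_sum fun x _ => ?_
        split_ifs <;> simp
    _ = _ := by
        rw [Finset.sum_add_distrib, Finset.sum_ite_eq]
        simp
        ring

/-- For a fixed centre the sum over chord tuples factors over the k triangles. The first term is for
different centres, where only chords can be shared; it is also left in, as slack, for the equal
centre, which gives the second term. -/
theorem sum_prod_overlap_le {k m r : ℕ} (z : Fin r × (Fin k → Fin m × Fin m)) {A B : ℝ}
    (hA : 0 ≤ A) (hB : 0 ≤ B) :
    ∑ z' : Fin r × (Fin k → Fin m × Fin m),
      ∏ i, ((if z.1 = z'.1 ∧ (z.2 i).1 = (z'.2 i).1 then A else 1) *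
        (if z.1 = z'.1 ∧ (z.2 i).2 = (z'.2 i).2 then A else 1) *
        (if z.2 i = z'.2 i then B else 1)) ≤
      r * ((m : ℝ) ^ 2 + B) ^ k + ((m : ℝ) ^ 2 + 2 * m * A + A ^ 2 * B) ^ k := by
  rw [Fintype.sum_prod_type]
  calc _ ≤ ∑ v : Fin r, (((m : ℝ) ^ 2 + B) ^ k +
        if z.1 = v then ((m : ℝ) ^ 2 + 2 * m * A + A ^ 2 * B) ^ k else 0) := by
        refine Finset.sum_le_sum fun v _ => ?_
        by_cases hv : z.1 = v
        · simp only [hv, true_and, if_true]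
          have h := Finset.prod_univ_sum (fun _ : Fin k => (Finset.univ : Finset (Fin m × Fin m)))
            (fun i x => ((if (z.2 i).1 = x.1 then A else 1) * (if (z.2 i).2 = x.2 then A else 1) *
              (if z.2 i = x then B else 1)))
          rw [Fintype.piFinset_univ] at h
          rw [← h]
          refine (Finset.prod_le_prod (fun i _ => ?_) fun i _ =>
            sum_overlap_weight_le (z.2 i) B hA).trans ?_
          · refine Finset.sum_nonneg fun x _ => ?_
            split_ifs <;> positivity
          · rw [Finset.prod_const, Finset.card_univ, Fintype.card_fin]
            have : 0 ≤ ((m : ℝ) ^ 2 + B) ^ k := by positivity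
            linarith
        · simp only [hv, false_and, if_false, one_mul, add_zero]
          have h := Finset.prod_univ_sum (fun _ : Fin k => (Finset.univ : Finset (Fin m × Fin m)))
            (fun i x => (if z.2 i = x then B else 1))
          rw [Fintype.piFinset_univ] at h
          rw [← h]
          refine (Finset.prod_le_prod (fun i _ => ?_) fun i _ =>
            sum_chord_weight_le (z.2 i) B).trans_eq ?_
          · refine Finset.sum_nonneg fun x _ => ?_
            split_ifs <;> positivity
          · rw [Finset.prod_const, Finset.card_univ, Fintype.card_fin]
    _ = _ := by
        rw [Finset.sum_add_distrib, Finset.sum_ite_eq]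
        simp

/-- A pair of planned fans is timely with probability at most the product for two separate fans,
multiplied by the inverse probability of each shared edge. Their union has at most 6k edges, whence
the condition on `M`. -/
theorem sum_sq_fanCount_le {w₁ w₂ : ℕ} (hw₁ : 0 < w₁) (hw₂ : 0 < w₂)
    (hw : w₁ + w₂ ≤ n.choose 2) {M : ℝ} (hM : 0 < M) (hMN : M + 6 * k ≤ n.choose 2 + 1) :
    ∑ π : EdgeOrder n, (fanCount emb w₁ w₂ π : ℝ) ^ 2 ≤
      Fintype.card (EdgeOrder n) * (r * (m : ℝ) ^ (2 * k) *
        (((w₁ / M) ^ 2 * (w₂ / M)) ^ k) ^ 2 *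
        (r * ((m : ℝ) ^ 2 + (w₂ / M)⁻¹) ^ k +
          ((m : ℝ) ^ 2 + 2 * m * (w₁ / M)⁻¹ + ((w₁ / M)⁻¹) ^ 2 * (w₂ / M)⁻¹) ^ k)) := by
  classical
  set P : Finset (Fin (n.choose 2)) → ℝ := fun W => W.card / M with hP
  have hc₁ : P (firstWindow n w₁) = w₁ / M := by simp [hP, card_firstWindow (n := n) (w₁ := w₁) (by omega)]
  have hc₂ : P (secondWindow n w₁ w₂) = w₂ / M := by simp [hP, card_secondWindow hw]
  have hp₁ : 0 < (w₁ : ℝ) / M := by positivity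
  have hp₂ : 0 < (w₂ : ℝ) / M := by positivity
  have hpos : ∀ e, 0 < P (edgeWindow emb w₁ w₂ e) := by
    intro e
    unfold edgeWindow
    split_ifs
    · rwa [hc₁]
    · rwa [hc₂]
  have h1 : ∑ π : EdgeOrder n, (fanCount emb w₁ w₂ π : ℝ) ^ 2 =
      ∑ z : Fin r × (Fin k → Fin m × Fin m), ∑ z' : Fin r × (Fin k → Fin m × Fin m),
        ((Finset.univ.filter fun π : EdgeOrder n =>
          ∀ e ∈ fanPlanEdges emb z ∪ fanPlanEdges emb z',
            π.symm e ∈ edgeWindow emb w₁ w₂ e).card : ℝ) := by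
    simp only [fanCount, Finset.card_filter, sq]
    push_cast
    simp only [Finset.sum_mul_sum]
    rw [Finset.sum_comm]
    refine Finset.sum_congr rfl fun z _ => ?_
    rw [Finset.sum_comm]
    refine Finset.sum_congr rfl fun z' _ => Finset.sum_congr rfl fun π _ => ?_
    simp only [Finset.mem_union, or_imp, forall_and]
    split_ifs <;> simp_all
  rw [h1]
  have h2 : ∀ z z', ((Finset.univ.filter fun π : EdgeOrder n =>
          ∀ e ∈ fanPlanEdges emb z ∪ fanPlanEdges emb z',
            π.symm e ∈ edgeWindow emb w₁ w₂ e).card : ℝ) ≤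
      Fintype.card (EdgeOrder n) * ((((w₁ / M) ^ 2 * (w₂ / M)) ^ k) ^ 2 *
        ∏ i, ((if z.1 = z'.1 ∧ (z.2 i).1 = (z'.2 i).1 then ((w₁ : ℝ) / M)⁻¹ else 1) *
        (if z.1 = z'.1 ∧ (z.2 i).2 = (z'.2 i).2 then ((w₁ : ℝ) / M)⁻¹ else 1) *
        (if z.2 i = z'.2 i then ((w₂ : ℝ) / M)⁻¹ else 1))) := by
    intro z z'
    have hcard : ((fanPlanEdges emb z ∪ fanPlanEdges emb z').card : ℝ) ≤ 6 * k := by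
      have := Finset.card_union_le (fanPlanEdges emb z) (fanPlanEdges emb z')
      rw [card_fanPlanEdges, card_fanPlanEdges] at this
      have h : (fanPlanEdges emb z ∪ fanPlanEdges emb z').card ≤ 6 * k := by omega
      exact_mod_cast h
    refine (EdgeOrder.card_window_le _ _ hM (by linarith)).trans (le_of_eq ?_)
    congr 1
    have e1 := Finset.prod_union_inter (s₁ := fanPlanEdges emb z) (s₂ := fanPlanEdges emb z')
      (f := fun e => P (edgeWindow emb w₁ w₂ e))
    have e2 := prod_inter_fanPlanEdges emb w₁ w₂ z z' fun W => (P W)⁻¹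
    rw [Finset.prod_inv_distrib] at e2
    rw [prod_fanPlanEdges, prod_fanPlanEdges] at e1
    rw [hc₁, hc₂] at e1 e2
    rw [← e2, sq, ← e1, mul_inv_cancel_right₀]
    exact (Finset.prod_pos fun e _ => hpos e).ne'
  calc _ ≤ ∑ z : Fin r × (Fin k → Fin m × Fin m), (Fintype.card (EdgeOrder n) : ℝ) *
        ((((w₁ / M) ^ 2 * (w₂ / M)) ^ k) ^ 2 * (r * ((m : ℝ) ^ 2 + (w₂ / M)⁻¹) ^ k +
          ((m : ℝ) ^ 2 + 2 * m * (w₁ / M)⁻¹ + ((w₁ / M)⁻¹) ^ 2 * (w₂ / M)⁻¹) ^ k)) := by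
        refine Finset.sum_le_sum fun z _ => (Finset.sum_le_sum fun z' _ => h2 z z').trans ?_
        rw [← Finset.mul_sum, ← Finset.mul_sum]
        gcongr
        exact sum_prod_overlap_le z (by positivity) (by positivity)
    _ = _ := by
        rw [Finset.sum_const, Finset.card_univ, nsmul_eq_mul]
        simp only [Fintype.card_prod, Fintype.card_fin, Fintype.card_fun]
        push_cast
        ring

/-- Linearity of expectation over the 2km potential star edges and k m^2 potential triangles at each
centre. -/
theorem sum_fanCost_le {w₁ w₂ : ℕ} (hw : w₁ + w₂ ≤ n.choose 2) {M : ℝ} (hM : 0 < M)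
    (hMN : M + 3 ≤ n.choose 2 + 1) :
    ∑ π : EdgeOrder n, (fanCost emb w₁ w₂ π : ℝ) ≤
      Fintype.card (EdgeOrder n) * (r * (2 * k * m * (w₁ / M) +
        k * (m : ℝ) ^ 2 * ((w₁ / M) ^ 2 * (w₂ / M)))) := by
  classical
  have hc₁ : (firstWindow n w₁).card = w₁ := card_firstWindow (by omega)
  have hc₂ : (secondWindow n w₁ w₂).card = w₂ := card_secondWindow hw
  have h1 : ∀ v x, ((Finset.univ.filter fun π : EdgeOrder n =>
      (π.symm (starEdge emb v x) : ℕ) < w₁).card : ℝ) ≤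
        Fintype.card (EdgeOrder n) * (w₁ / M) := by
    intro v x
    have h := EdgeOrder.card_window_le {starEdge emb v x} (edgeWindow emb w₁ w₂) hM
      (by rw [Finset.card_singleton]; push_cast; linarith)
    rw [Finset.prod_singleton, edgeWindow_star, hc₁] at h
    simpa [edgeWindow_star, firstWindow] using h
  have h2 : ∀ v i y, ((Finset.univ.filter fun π : EdgeOrder n =>
      TriangleTimely emb w₁ w₂ π v i y).card : ℝ) ≤
        Fintype.card (EdgeOrder n) * ((w₁ / M) ^ 2 * (w₂ / M)) := by
    intro v i y
    have hne : starEdge emb v (i, false, y.1) ≠ starEdge emb v (i, true, y.2) := by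
      simp [starEdge_inj]
    have hcard : (({starEdge emb v (i, false, y.1), starEdge emb v (i, true, y.2),
        chordEdge emb i y} : Finset (CompleteEdge n)).card : ℝ) ≤ 3 := by
      exact_mod_cast Finset.card_le_three
    have h := EdgeOrder.card_window_le {starEdge emb v (i, false, y.1),
      starEdge emb v (i, true, y.2), chordEdge emb i y} (edgeWindow emb w₁ w₂) hM (by linarith)
    rw [Finset.prod_insert (by simp [hne, starEdge_ne_chordEdge]),
      Finset.prod_insert (by simp [starEdge_ne_chordEdge]), Finset.prod_singleton] at h
    simp only [edgeWindow_star, edgeWindow_chord, hc₁, hc₂] at h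
    refine le_trans (le_of_eq ?_) (h.trans_eq (by ring))
    congr 2
    ext π
    simp [TriangleTimely, edgeWindow_star, edgeWindow_chord, firstWindow, secondWindow, and_assoc]
  have h3 : ∑ π : EdgeOrder n, (fanCost emb w₁ w₂ π : ℝ) =
      ∑ z : Fin r × Fin k × Bool × Fin m, ((Finset.univ.filter fun π : EdgeOrder n =>
        (π.symm (starEdge emb z.1 z.2) : ℕ) < w₁).card : ℝ) +
      ∑ z : Fin r × Fin k × Fin m × Fin m, ((Finset.univ.filter fun π : EdgeOrder n =>
        TriangleTimely emb w₁ w₂ π z.1 z.2.1 z.2.2).card : ℝ) := by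
    simp only [fanCost, Finset.card_filter]
    push_cast
    rw [Finset.sum_add_distrib]
    congr 1 <;> exact Finset.sum_comm
  rw [h3]
  refine (add_le_add (Finset.sum_le_sum fun z _ => h1 z.1 z.2)
    (Finset.sum_le_sum fun z _ => h2 z.1 z.2.1 z.2.2)).trans_eq ?_
  simp only [Finset.sum_const, Finset.card_univ, nsmul_eq_mul, Fintype.card_prod, Fintype.card_fin,
    Fintype.card_bool]
  push_cast
  ring

/-- Lower bound for the success probability of the strategy, by the second moment method for the
number of timely fans and Markov's inequality for the cost. -/
theorem le_successCount_ofRule {w₁ w₂ t b : ℕ} (hk : 1 ≤ k) (hr : 0 < r) (hm : 0 < m)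
    (hb : 0 < b) (hw₁ : 0 < w₁) (hw₂ : 0 < w₂) (hwt : w₁ + w₂ ≤ t) (ht : t ≤ n.choose 2) {M : ℝ}
    (hM : 0 < M) (hMN : M + 6 * k ≤ n.choose 2 + 1) :
    (((w₁.descFactorial (2 * k) : ℝ) * w₂.descFactorial k / (n.choose 2 : ℝ) ^ (3 * k)) ^ 2 /
        ((((w₁ / M) ^ 2 * (w₂ / M)) ^ k) ^ 2 * ((1 + ((m : ℝ) ^ 2 * (w₂ / M))⁻¹) ^ k +
          (r : ℝ)⁻¹ * (1 + 2 * (m * (w₁ / M))⁻¹ +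
            ((m : ℝ) ^ 2 * ((w₁ / M) ^ 2 * (w₂ / M)))⁻¹) ^ k)) -
      r * (2 * k * m * (w₁ / M) + k * (m : ℝ) ^ 2 * ((w₁ / M) ^ 2 * (w₂ / M))) / b) *
        Fintype.card (EdgeOrder n) ≤
      ((Strategy.ofRule t b (fanRule emb w₁ w₂)).successCount (triangleFan k) : ℝ) := by
  classical
  have hw : w₁ + w₂ ≤ n.choose 2 := hwt.trans ht
  have hN : 0 < n.choose 2 := by omega
  have hT : 0 < (Fintype.card (EdgeOrder n) : ℝ) := by exact_mod_cast Fintype.card_pos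
  have hk' : (1 : ℝ) ≤ k := by exact_mod_cast hk
  set T : ℝ := ((Fintype.card (EdgeOrder n) : ℕ) : ℝ) with hTdef
  set q : ℝ := (w₁.descFactorial (2 * k) : ℝ) * w₂.descFactorial k / (n.choose 2 : ℝ) ^ (3 * k)
    with hq
  have hq0 : 0 ≤ q := by positivity
  set p₁ : ℝ := w₁ / M with hp₁
  set p₂ : ℝ := w₂ / M with hp₂
  have hp₁0 : 0 < p₁ := by positivity
  have hp₂0 : 0 < p₂ := by positivity
  have hr' : (0 : ℝ) < r := by exact_mod_cast hr
  have hm' : (0 : ℝ) < m := by exact_mod_cast hm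
  have hb' : (0 : ℝ) < b := by exact_mod_cast hb
  set Z : ℝ := (1 + ((m : ℝ) ^ 2 * p₂)⁻¹) ^ k + (r : ℝ)⁻¹ * (1 + 2 * (m * p₁)⁻¹ +
            ((m : ℝ) ^ 2 * (p₁ ^ 2 * p₂))⁻¹) ^ k with hZ
  have hZ0 : 0 < Z := by positivity
  set Q : ℝ := ((p₁ ^ 2 * p₂) ^ k) ^ 2 with hQ
  have hQ0 : 0 < Q := by positivity
  have hfirst := le_sum_fanCount emb hw hN
  have hsecond := sum_sq_fanCount_le emb hw₁ hw₂ hw hM hMN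
  have hcost := sum_fanCost_le emb hw hM (by linarith)
  -- Factoring out `r * m ^ (2 * k)`, the number of planned fans, from the overlap sum leaves `Z`.
  have hZ' : r * ((m : ℝ) ^ 2 + p₂⁻¹) ^ k +
      ((m : ℝ) ^ 2 + 2 * m * p₁⁻¹ + (p₁⁻¹) ^ 2 * p₂⁻¹) ^ k = r * (m : ℝ) ^ (2 * k) * Z := by
    have e1 : (m : ℝ) ^ 2 + p₂⁻¹ = (m : ℝ) ^ 2 * (1 + ((m : ℝ) ^ 2 * p₂)⁻¹) := by
      field_simp
    have e2 : (m : ℝ) ^ 2 + 2 * m * p₁⁻¹ + (p₁⁻¹) ^ 2 * p₂⁻¹ = (m : ℝ) ^ 2 *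
        (1 + 2 * (m * p₁)⁻¹ + ((m : ℝ) ^ 2 * (p₁ ^ 2 * p₂))⁻¹) := by
      field_simp
    rw [e1, e2, mul_pow, mul_pow, ← pow_mul, hZ]
    field_simp
  rw [← hTdef] at hfirst hsecond hcost
  rw [hZ'] at hsecond
  have hCS := sq_sum_le_card_filter_pos_mul (Finset.univ : Finset (EdgeOrder n))
    (fanCount emb w₁ w₂)
  set G : Finset (EdgeOrder n) := Finset.univ.filter fun π => 0 < fanCount emb w₁ w₂ π with hG
  have hGbound : q ^ 2 / (Q * Z) * T ≤ G.card := by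
    have h1 : (T * (r * (m : ℝ) ^ (2 * k) * q)) ^ 2 ≤
        G.card * (T * (r * (m : ℝ) ^ (2 * k) * Q * (r * (m : ℝ) ^ (2 * k) * Z))) := by
      refine le_trans ?_ (hCS.trans (mul_le_mul_of_nonneg_left hsecond (Nat.cast_nonneg _)))
      exact pow_le_pow_left₀ (by positivity) hfirst 2
    have h2 : 0 < T * (r * (m : ℝ) ^ (2 * k)) ^ 2 := by positivity
    rw [div_mul_eq_mul_div, div_le_iff₀ (by positivity)]
    refine le_of_mul_le_mul_left ?_ h2
    linarith
  -- The orders that are too expensive; Markov's inequality bounds their number.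
  set D : Finset (EdgeOrder n) := Finset.univ.filter fun π => b < fanCost emb w₁ w₂ π with hD
  have hDbound : (D.card : ℝ) ≤
      r * (2 * k * m * p₁ + k * (m : ℝ) ^ 2 * (p₁ ^ 2 * p₂)) / b * T := by
    rw [div_mul_eq_mul_div, le_div_iff₀ hb']
    calc (D.card : ℝ) * b = ∑ π ∈ D, (b : ℝ) := by rw [Finset.sum_const, nsmul_eq_mul]
      _ ≤ ∑ π ∈ D, (fanCost emb w₁ w₂ π : ℝ) := by
          refine Finset.sum_le_sum fun π hπ => ?_
          exact_mod_cast (Finset.mem_filter.1 hπ).2.le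
      _ ≤ ∑ π : EdgeOrder n, (fanCost emb w₁ w₂ π : ℝ) :=
          Finset.sum_le_sum_of_subset_of_nonneg (Finset.subset_univ _) fun _ _ _ => by positivity
      _ ≤ _ := hcost.trans_eq (by ring)
  have hsub : G \ D ⊆ Finset.univ.filter fun π : EdgeOrder n =>
      (triangleFan k).IsContained
        ((Strategy.ofRule t b (fanRule emb w₁ w₂)).graphAt π t) := by
    intro π hπ
    obtain ⟨hπG, hπD⟩ := Finset.mem_sdiff.1 hπ
    have h1 : 0 < fanCount emb w₁ w₂ π := (Finset.mem_filter.1 hπG).2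
    have h2 : fanCost emb w₁ w₂ π ≤ b := by
      by_contra h
      exact hπD (Finset.mem_filter.2 ⟨Finset.mem_univ _, not_le.1 h⟩)
    obtain ⟨z, hz⟩ := Finset.card_pos.1 h1
    refine Finset.mem_filter.2 ⟨Finset.mem_univ _, ?_⟩
    exact isContained_graphAt_ofRule emb hwt π h2 z.1 z.2
      ((forall_triangleTimely_iff emb w₁ w₂ π z).2 (Finset.mem_filter.1 hz).2)
  have hcardGD : (G.card : ℝ) - D.card ≤
      (Strategy.ofRule t b (fanRule emb w₁ w₂)).successCount (triangleFan k) := by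
    have h1 := Finset.card_le_card hsub
    have h2 := Finset.le_card_sdiff D G
    have h3 : G.card ≤ (Strategy.ofRule t b (fanRule emb w₁ w₂)).successCount (triangleFan k) +
        D.card := by
      unfold Strategy.successCount
      omega
    have : (G.card : ℝ) ≤ (Strategy.ofRule t b (fanRule emb w₁ w₂)).successCount (triangleFan k) +
        D.card := by exact_mod_cast h3
    linarith
  rw [sub_mul]
  linarith

end FanMoments

/-! ### Choice of the parameters of the strategy. -/

theorem sq_le_four_mul_choose_two {n : ℕ} (hn : 2 ≤ n) : (n : ℝ) ^ 2 ≤ 4 * (n.choose 2 : ℝ) := by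
  rw [Nat.cast_choose_two]
  have : (2 : ℝ) ≤ n := by exact_mod_cast hn
  nlinarith

theorem choose_two_add_one_le_sq {n : ℕ} (hn : 1 ≤ n) : (n.choose 2 : ℝ) + 1 ≤ (n : ℝ) ^ 2 := by
  rw [Nat.cast_choose_two]
  have : (1 : ℝ) ≤ n := by exact_mod_cast hn
  nlinarith

/-- The left side is the order of the cost, D / μ^k. For t^3 ≤ n^4 it is at most the first term of
the threshold, otherwise at most the second. -/
theorem div_pow_le_budgetThreshold {k n t : ℕ} (hk : 1 ≤ k) (hn : 0 < n) (ht : 0 < t) :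
    min ((t : ℝ) / n) (n / √t) / (min ((t : ℝ) ^ 3 / (n : ℝ) ^ 4) 1) ^ k ≤
      budgetThreshold k n t := by
  have hn' : (0 : ℝ) < n := by exact_mod_cast hn
  have ht' : (0 : ℝ) < t := by exact_mod_cast ht
  rcases le_total ((t : ℝ) ^ 3 / (n : ℝ) ^ 4) 1 with h | h
  · refine le_trans ?_ (le_max_left _ _)
    rw [min_eq_left h]
    have e1 : (n : ℝ) ^ (4 * k - 1) / (t : ℝ) ^ (3 * k - 1) =
        ((t : ℝ) / n) / ((t : ℝ) ^ 3 / (n : ℝ) ^ 4) ^ k := by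
      have h1 : (n : ℝ) ^ (4 * k) = n ^ (4 * k - 1) * n := by
        rw [← pow_succ]; congr 1; omega
      have h2 : (t : ℝ) ^ (3 * k) = t ^ (3 * k - 1) * t := by
        rw [← pow_succ]; congr 1; omega
      rw [div_pow, ← pow_mul, ← pow_mul, h1, h2]
      field_simp
    rw [e1]
    gcongr
    exact min_le_left _ _
  · refine le_trans ?_ (le_max_right _ _)
    rw [min_eq_right h, one_pow, div_one]
    exact min_le_right _ _

-- The parameters are w₁ ≈ nD/2, w₂ ≈ t/2, m ≈ n/(4k) and r = ⌈L/μ^k⌉. The descending factorial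
-- ratios and the power of (N + 1 - 6k)/N are the discrepancy between exact and independent
-- positions. The first denominator term comes from pairs of fans with different centres, the second
-- from those with the same centre, and the subtracted term is the risk of overspending.
set_option maxHeartbeats 2000000 in
theorem exists_strategy_successCount_ge {k n t b : ℕ} (hk : 1 ≤ k) {L : ℝ} (hL : 1 ≤ L)
    (hn : 48 * k ≤ n) (hnt : n ≤ t) (ht : t ≤ n.choose 2) (hb : 0 < b)
    (hr : L / (min ((t : ℝ) ^ 3 / (n : ℝ) ^ 4) 1) ^ k + 1 ≤ n / 2) :
    ∃ σ : Strategy n t b, σ.IsGraphBased ∧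
      (((⌊min (t : ℝ) (n ^ 2 / √t) / 2⌋₊).descFactorial (2 * k) /
            (⌊min (t : ℝ) (n ^ 2 / √t) / 2⌋₊ : ℝ) ^ (2 * k) *
          ((t / 2).descFactorial k / ((t / 2 : ℕ) : ℝ) ^ k) *
          (((n.choose 2 : ℝ) + 1 - 6 * k) / n.choose 2) ^ (3 * k)) ^ 2 /
          ((1 + 256 * k ^ 2 / t) ^ k + (1 + 64 * k + 4096 * k ^ 2) ^ k / L) -
        144 * k * L * (budgetThreshold k n t / b)) * Fintype.card (EdgeOrder n) ≤
      σ.successCount (triangleFan k) := by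
  have hk' : (1 : ℝ) ≤ k := by exact_mod_cast hk
  have hn' : 48 * (k : ℝ) ≤ n := by exact_mod_cast hn
  have hn0 : (0 : ℝ) < n := by linarith
  have hnt' : (n : ℝ) ≤ t := by exact_mod_cast hnt
  have ht0 : (0 : ℝ) < t := by linarith
  have hb0 : (0 : ℝ) < b := by exact_mod_cast hb
  have hnN : (n : ℝ) ^ 2 ≤ 4 * (n.choose 2 : ℝ) := sq_le_four_mul_choose_two (by omega)
  have hNn : (n.choose 2 : ℝ) + 1 ≤ (n : ℝ) ^ 2 := choose_two_add_one_le_sq (by omega)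
  have htN : (t : ℝ) ≤ n.choose 2 := by exact_mod_cast ht
  set s : ℝ := √t with hs
  have hs0 : 0 < s := Real.sqrt_pos.2 ht0
  have hss : s ^ 2 = t := Real.sq_sqrt ht0.le
  have hsn : s ≤ n := by
    rw [hs]; exact Real.sqrt_le_iff.2 ⟨hn0.le, by linarith⟩
  set μ : ℝ := min ((t : ℝ) ^ 3 / (n : ℝ) ^ 4) 1 with hμ
  have hμ0 : 0 < μ := lt_min (by positivity) one_pos
  have hμ1 : μ ≤ 1 := min_le_right _ _
  -- Order of the number of star edges bought per centre; the cut at n/√t is where D^2 t / n^2, the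
  -- order of the number of triangles, reaches 1.
  set D : ℝ := min ((t : ℝ) / n) (n / s) with hD
  have hD1 : 1 ≤ D := le_min ((one_le_div hn0).2 hnt') ((one_le_div hs0).2 hsn)
  have hDb : D / μ ^ k ≤ budgetThreshold k n t :=
    div_pow_le_budgetThreshold hk (by omega) (by omega)
  have hDμ : D ^ 2 * t / n ^ 2 = μ := by
    rw [hD, hμ]
    have e1 : ((t : ℝ) / n) ^ 2 * t / n ^ 2 = t ^ 3 / n ^ 4 := by field_simp
    have e2 : ((n : ℝ) / s) ^ 2 * t / n ^ 2 = 1 := by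
      rw [← hss]; field_simp
    have hmono : ∀ a b : ℝ, 0 ≤ a → a ≤ b → a ^ 2 * t / n ^ 2 ≤ b ^ 2 * t / n ^ 2 := by
      intro a b ha hab; gcongr
    rcases le_total ((t : ℝ) / n) (n / s) with h | h
    · have := hmono _ _ (by positivity) h
      rw [e1, e2] at this
      rw [min_eq_left h, min_eq_left this, e1]
    · have := hmono _ _ (by positivity) h
      rw [e1, e2] at this
      rw [min_eq_right h, min_eq_right this, e2]
  have hnD : min (t : ℝ) (n ^ 2 / s) = n * D := by
    rw [hD, mul_min_of_nonneg _ _ hn0.le]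
    congr 1 <;> field_simp
  rw [hnD]
  set w₁ : ℕ := ⌊(n : ℝ) * D / 2⌋₊ with hw₁
  set w₂ : ℕ := t / 2 with hw₂
  have hnD0 : (n : ℝ) ≤ n * D := by nlinarith
  have hnDt : (n : ℝ) * D ≤ t := by rw [← hnD]; exact min_le_left _ _
  have hw₁le : (w₁ : ℝ) ≤ n * D / 2 := Nat.floor_le (by positivity)
  have hw₁ge : (n : ℝ) * D / 4 ≤ w₁ := by
    have := Nat.lt_floor_add_one ((n : ℝ) * D / 2)
    rw [← hw₁] at this
    linarith
  have hw₂le : (w₂ : ℝ) ≤ t / 2 := Nat.cast_div_le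
  have hw₂ge : (t : ℝ) / 4 ≤ w₂ := by
    have h1 : t ≤ 2 * w₂ + 1 := by omega
    have h2 : (t : ℝ) ≤ 2 * w₂ + 1 := by exact_mod_cast h1
    linarith
  have hw₁0 : (0 : ℝ) < w₁ := by linarith
  have hw₂0 : (0 : ℝ) < w₂ := by linarith
  have hwt : w₁ + w₂ ≤ t := by
    have : (w₁ : ℝ) + w₂ ≤ t := by linarith
    exact_mod_cast this
  -- The 2k classes of leaves occupy at most n/2 vertices; `hr` leaves the other half for the
  -- centres.
  set m : ℕ := n / (4 * k) with hm
  have hmle : 4 * k * m ≤ n := Nat.mul_div_le _ _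
  have hmle' : 4 * (k : ℝ) * m ≤ n := by exact_mod_cast hmle
  have hmge : (n : ℝ) / (8 * k) ≤ m := by
    have h1 : n < 4 * k * (m + 1) := by
      rw [hm]; exact Nat.lt_mul_div_succ n (by omega)
    have h2 : (n : ℝ) < 4 * k * (m + 1) := by exact_mod_cast h1
    rw [div_le_iff₀ (by positivity)]
    nlinarith
  have hm0 : (0 : ℝ) < m := lt_of_lt_of_le (by positivity) hmge
  have hmn : (m : ℝ) ≤ n := by nlinarith
  have hLμ : 1 ≤ L / μ ^ k := by
    rw [one_le_div (by positivity)]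
    exact (pow_le_one₀ hμ0.le hμ1).trans hL
  set r : ℕ := ⌈L / μ ^ k⌉₊ with hrdef
  have hrge : L / μ ^ k ≤ r := Nat.le_ceil _
  have hrle : (r : ℝ) < L / μ ^ k + 1 := Nat.ceil_lt_add_one (by linarith)
  have hr0 : (0 : ℝ) < r := by linarith
  have hcard : r + 2 * k * m ≤ n := by
    have : (r : ℝ) + 2 * k * m ≤ n := by linarith
    exact_mod_cast this
  obtain ⟨emb⟩ : Nonempty (Fin r ⊕ (Fin k × Bool × Fin m) ↪ Fin n) := by
    rw [Function.Embedding.nonempty_iff_card_le]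
    simp only [Fintype.card_sum, Fintype.card_fin, Fintype.card_prod, Fintype.card_bool]
    calc _ = r + 2 * k * m := by ring
      _ ≤ n := hcard
  set M : ℝ := (n.choose 2 : ℝ) + 1 - 6 * k with hM
  -- From N ≥ n^2/4 and 6k ≤ n/8 ≤ n^2/8; this uses 48k ≤ n.
  have hMge : (n : ℝ) ^ 2 / 8 ≤ M := by rw [hM]; nlinarith
  have hMle : M ≤ (n : ℝ) ^ 2 := by linarith
  have hM0 : 0 < M := lt_of_lt_of_le (by positivity) hMge
  have hN0 : (0 : ℝ) < n.choose 2 := by nlinarith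
  refine ⟨Strategy.ofRule t b (fanRule emb w₁ w₂), Strategy.isGraphBased_ofRule _, ?_⟩
  refine le_trans (mul_le_mul_of_nonneg_right ?_ (Nat.cast_nonneg _))
    (le_successCount_ofRule emb hk (by exact_mod_cast hr0) (by exact_mod_cast hm0) hb
      (by exact_mod_cast hw₁0) (by exact_mod_cast hw₂0) hwt ht hM0 (by rw [hM]; linarith))
  have hp₂ge : (t : ℝ) / (4 * n ^ 2) ≤ w₂ / M := by
    calc (t : ℝ) / (4 * n ^ 2) = (t / 4) / n ^ 2 := by field_simp
      _ ≤ w₂ / M := by gcongr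
  have hp₁ge : D / (4 * n) ≤ w₁ / M := by
    calc D / (4 * n) = (n * D / 4) / n ^ 2 := by field_simp
      _ ≤ w₁ / M := by gcongr
  have hp₂le : w₂ / M ≤ 4 * t / n ^ 2 := by
    calc (w₂ : ℝ) / M ≤ (t / 2) / (n ^ 2 / 8) := by gcongr
      _ = 4 * t / n ^ 2 := by field_simp; norm_num
  have hp₁le : w₁ / M ≤ 4 * D / n := by
    calc (w₁ : ℝ) / M ≤ (n * D / 2) / (n ^ 2 / 8) := by gcongr
      _ = 4 * D / n := by field_simp; norm_num
  have hsplit : ((w₁.descFactorial (2 * k) : ℝ) * w₂.descFactorial k /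
      (n.choose 2 : ℝ) ^ (3 * k)) ^ 2 = (((w₁ / M) ^ 2 * (w₂ / M)) ^ k) ^ 2 *
      ((w₁.descFactorial (2 * k) : ℝ) / (w₁ : ℝ) ^ (2 * k) *
        (w₂.descFactorial k / (w₂ : ℝ) ^ k) * (M / n.choose 2) ^ (3 * k)) ^ 2 := by
    rw [← mul_pow]
    congr 1
    have e : ((w₁ / M) ^ 2 * (w₂ / M)) ^ k = (w₁ : ℝ) ^ (2 * k) * (w₂ : ℝ) ^ k / M ^ (3 * k) := by
      rw [mul_pow, ← pow_mul, div_pow, div_pow, div_mul_div_comm, ← pow_add]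
      congr 2; ring
    rw [e, div_pow]
    field_simp
  refine sub_le_sub ?_ ?_
  · rw [hsplit, mul_div_mul_left _ _ (by positivity)]
    refine div_le_div_of_nonneg_left (by positivity) (by positivity) (add_le_add ?_ ?_)
    · have h1 : (t : ℝ) / (256 * k ^ 2) ≤ (m : ℝ) ^ 2 * (w₂ / M) := by
        calc (t : ℝ) / (256 * k ^ 2) = (n / (8 * k)) ^ 2 * (t / (4 * n ^ 2)) := by
              field_simp; norm_num
          _ ≤ _ := by gcongr
      have h2 : ((m : ℝ) ^ 2 * (w₂ / M))⁻¹ ≤ 256 * k ^ 2 / t := by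
        rw [← inv_div (t : ℝ)]
        exact inv_anti₀ (by positivity) h1
      gcongr
    · have h1 : 1 / (32 * k) ≤ (m : ℝ) * (w₁ / M) := by
        calc 1 / (32 * (k : ℝ)) ≤ D / (32 * k) := by gcongr
          _ = (n / (8 * k)) * (D / (4 * n)) := by field_simp; norm_num
          _ ≤ _ := by gcongr
      have h2 : μ / (4096 * k ^ 2) ≤ (m : ℝ) ^ 2 * ((w₁ / M) ^ 2 * (w₂ / M)) := by
        calc μ / (4096 * (k : ℝ) ^ 2) =
              (n / (8 * k)) ^ 2 * ((D / (4 * n)) ^ 2 * (t / (4 * n ^ 2))) := by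
              rw [← hDμ]; field_simp; norm_num
          _ ≤ _ := by gcongr
      have h3 : ((m : ℝ) * (w₁ / M))⁻¹ ≤ 32 * k := by
        rw [← inv_inv (32 * (k : ℝ)), ← one_div (32 * (k : ℝ))]
        exact inv_anti₀ (by positivity) h1
      have h4 : ((m : ℝ) ^ 2 * ((w₁ / M) ^ 2 * (w₂ / M)))⁻¹ ≤ 4096 * k ^ 2 / μ := by
        rw [← inv_div μ]
        exact inv_anti₀ (by positivity) h2
      -- All terms are put over μ ≤ 1, so that the kth power cancels against r ≥ L / μ^k.
      have h5 : 1 + 2 * ((m : ℝ) * (w₁ / M))⁻¹ + ((m : ℝ) ^ 2 * ((w₁ / M) ^ 2 * (w₂ / M)))⁻¹ ≤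
          (1 + 64 * k + 4096 * k ^ 2) / μ := by
        have h6 : 1 + 64 * (k : ℝ) ≤ (1 + 64 * k) / μ := by
          rw [le_div_iff₀ hμ0]
          exact mul_le_of_le_one_right (by positivity) hμ1
        rw [add_div]
        linarith
      calc (r : ℝ)⁻¹ * (1 + 2 * ((m : ℝ) * (w₁ / M))⁻¹ +
            ((m : ℝ) ^ 2 * ((w₁ / M) ^ 2 * (w₂ / M)))⁻¹) ^ k
          ≤ (L / μ ^ k)⁻¹ * ((1 + 64 * k + 4096 * k ^ 2) / μ) ^ k := by
            gcongr
        _ = _ := by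
            rw [div_pow]
            field_simp
  · have h1 : 2 * k * m * (w₁ / M) ≤ 8 * k * D := by
      calc 2 * k * m * (w₁ / M) ≤ 2 * k * n * (4 * D / n) := by gcongr
        _ = 8 * k * D := by field_simp; norm_num
    have h2 : k * (m : ℝ) ^ 2 * ((w₁ / M) ^ 2 * (w₂ / M)) ≤ 64 * k * D := by
      calc k * (m : ℝ) ^ 2 * ((w₁ / M) ^ 2 * (w₂ / M))
          ≤ k * (n : ℝ) ^ 2 * ((4 * D / n) ^ 2 * (4 * t / n ^ 2)) := by gcongr
        _ = 64 * k * μ := by rw [← hDμ]; field_simp; norm_num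
        _ ≤ 64 * k * D := by gcongr; linarith
    -- 144 = 2 (8 + 64): rounding up at most doubles L / μ^k ≥ 1, and the chords cost O(μ) = O(D)
    -- per centre since μ ≤ 1 ≤ D.
    calc r * (2 * k * m * (w₁ / M) + k * (m : ℝ) ^ 2 * ((w₁ / M) ^ 2 * (w₂ / M))) / b
        ≤ (2 * (L / μ ^ k)) * (8 * k * D + 64 * k * D) / b := by
          gcongr
          linarith
      _ = 144 * k * L * ((D / μ ^ k) / b) := by ring
      _ ≤ _ := by gcongr

/-! ### Below the thresholds: success probability tends to zero. -/

theorem timeThreshold_pow {k : ℕ} (hk : 1 ≤ k) (n : ℕ) :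
    timeThreshold k n ^ (3 * k) = (n : ℝ) ^ (4 * k - 1) := by
  have hk' : (0 : ℝ) < k := by exact_mod_cast hk
  rw [timeThreshold, ← Real.rpow_natCast, ← Real.rpow_mul (Nat.cast_nonneg _),
    ← Real.rpow_natCast]
  congr 1
  rw [Nat.cast_sub (by omega)]
  push_cast
  field_simp

theorem le_timeThreshold {k n : ℕ} (hk : 1 ≤ k) (hn : 1 ≤ n) : (n : ℝ) ≤ timeThreshold k n := by
  have hk' : (1 : ℝ) ≤ k := by exact_mod_cast hk
  have hn' : (1 : ℝ) ≤ n := by exact_mod_cast hn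
  calc (n : ℝ) = (n : ℝ) ^ (1 : ℝ) := (Real.rpow_one _).symm
    _ ≤ timeThreshold k n := by
      refine Real.rpow_le_rpow_of_exponent_le hn' ?_
      rw [le_div_iff₀ (by positivity)]
      linarith

section UpperBounds

variable {n t b : ℕ}

/-- With N ≥ n^2/4, the quotient n^(2k-1) / N^(3k-1) is at most 4^(3k-1) / n^(4k-1). Keeping `min b
t` lets the bound serve both the budget and the time threshold. -/
theorem Strategy.successCount_le_of_fan (σ : Strategy n t b) (hn : 2 ≤ n) (ht : t ≤ n.choose 2)
    {k : ℕ} (hk : 1 ≤ k) :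
    (σ.successCount (triangleFan k) : ℝ) ≤ (6 * k * 4 ^ (3 * k - 1) *
      (min b t * t ^ (3 * k - 1) / n ^ (4 * k - 1))) * Fintype.card (EdgeOrder n) := by
  have h1 : (σ.successCount (triangleFan k) : ℝ) * (n.choose 2 : ℝ) ^ (3 * k - 1) ≤
      6 * k * (n : ℝ) ^ (2 * k - 1) * (min b t : ℕ) * (t : ℝ) ^ (3 * k - 1) *
        Fintype.card (EdgeOrder n) := by
    exact_mod_cast σ.successCount_triangleFan_mul_le ht hk
  have hn0 : (0 : ℝ) < n := by exact_mod_cast (by omega : 0 < n)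
  have h2 : ((n : ℝ) ^ 2 / 4) ^ (3 * k - 1) ≤ (n.choose 2 : ℝ) ^ (3 * k - 1) := by
    have := sq_le_four_mul_choose_two hn
    gcongr
    linarith
  have h3 : (0 : ℝ) < ((n : ℝ) ^ 2 / 4) ^ (3 * k - 1) := by positivity
  have h4 : ((n : ℝ) ^ 2 / 4) ^ (3 * k - 1) * 4 ^ (3 * k - 1) =
      (n : ℝ) ^ (2 * k - 1) * n ^ (4 * k - 1) := by
    rw [← mul_pow, div_mul_cancel₀ _ (by norm_num), ← pow_mul, ← pow_add]
    congr 1; omega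
  refine le_of_mul_le_mul_right ?_ h3
  calc _ ≤ (σ.successCount (triangleFan k) : ℝ) * (n.choose 2 : ℝ) ^ (3 * k - 1) := by gcongr
    _ ≤ _ := h1
    _ = 6 * k * ((n : ℝ) ^ (2 * k - 1) * n ^ (4 * k - 1)) *
        ((min b t : ℕ) * (t : ℝ) ^ (3 * k - 1) / n ^ (4 * k - 1)) *
          Fintype.card (EdgeOrder n) := by field_simp
    _ = _ := by rw [← h4]; push_cast; ring

theorem Strategy.successCount_le_of_triangle (σ : Strategy n t b) (hn : 2 ≤ n)
    (ht : t ≤ n.choose 2) {k : ℕ} (hk : 1 ≤ k) :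
    (σ.successCount (triangleFan k) : ℝ) ≤
      (16 * (b ^ 2 * t / n ^ 2)) * Fintype.card (EdgeOrder n) := by
  have h1 : (σ.successCount (triangleFan k) : ℝ) * (n.choose 2 : ℝ) ≤
      4 * (b : ℝ) ^ 2 * t * Fintype.card (EdgeOrder n) := by
    exact_mod_cast σ.successCount_triangleFan_mul_choose_le ht hk
  have hn0 : (0 : ℝ) < n := by exact_mod_cast (by omega : 0 < n)
  have h2 : (n : ℝ) ^ 2 / 4 ≤ n.choose 2 := by
    have := sq_le_four_mul_choose_two hn
    linarith
  have h3 : (0 : ℝ) < (n : ℝ) ^ 2 / 4 := by positivity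
  refine le_of_mul_le_mul_right ?_ h3
  calc _ ≤ (σ.successCount (triangleFan k) : ℝ) * (n.choose 2 : ℝ) := by gcongr
    _ ≤ _ := h1
    _ = _ := by field_simp; ring

theorem Strategy.probContains_le_ofReal {V : Type} (σ : Strategy n t b) (H : SimpleGraph V) {c : ℝ}
    (h : (σ.successCount H : ℝ) ≤ c * Fintype.card (EdgeOrder n)) :
    σ.toRandomized.probContains H ≤ ENNReal.ofReal c := by
  have hT : (0 : ℝ) < Fintype.card (EdgeOrder n) := by exact_mod_cast Fintype.card_pos
  rw [σ.probContains_toRandomized, ← ENNReal.ofReal_natCast, ← ENNReal.ofReal_natCast,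
    ← ENNReal.ofReal_div_of_pos hT]
  exact ENNReal.ofReal_le_ofReal ((div_le_iff₀ hT).2 h)

theorem Strategy.successCount_le_card {V : Type} (σ : Strategy n t b) (H : SimpleGraph V) :
    σ.successCount H ≤ Fintype.card (EdgeOrder n) := by
  classical
  exact Finset.card_filter_le _ _

theorem Strategy.successCount_le_ratio (σ : Strategy n t b) (hn : 2 ≤ n) (ht : t ≤ n.choose 2)
    {k : ℕ} (hk : 1 ≤ k) :
    (σ.successCount (triangleFan k) : ℝ) ≤ (6 * k * 4 ^ (3 * k - 1) * (b / budgetThreshold k n t) +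
      16 * (b / budgetThreshold k n t) ^ 2) * Fintype.card (EdgeOrder n) := by
  have hn0 : (0 : ℝ) < n := by exact_mod_cast (by omega : 0 < n)
  have hβ : 0 ≤ budgetThreshold k n t := le_max_of_le_right (by positivity)
  rcases Nat.eq_zero_or_pos t with rfl | ht0
  · have h := σ.successCount_le_of_triangle hn ht hk
    simp only [Nat.cast_zero, mul_zero, zero_div, zero_mul] at h
    exact h.trans (by positivity)
  have ht0 : (0 : ℝ) < t := by exact_mod_cast ht0
  rcases le_total ((n : ℝ) / √t) ((n : ℝ) ^ (4 * k - 1) / (t : ℝ) ^ (3 * k - 1)) with h | h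
  · rw [budgetThreshold, max_eq_left h]
    refine (σ.successCount_le_of_fan hn ht hk).trans ?_
    gcongr
    refine le_add_of_le_of_nonneg ?_ (by positivity)
    gcongr 6 * k * 4 ^ (3 * k - 1) * ?_
    rw [div_div_eq_mul_div]
    gcongr
    exact min_le_left _ _
  · rw [budgetThreshold, max_eq_right h]
    refine (σ.successCount_le_of_triangle hn ht hk).trans ?_
    gcongr
    refine le_add_of_nonneg_of_le (by positivity) (le_of_eq ?_)
    rw [div_div_eq_mul_div, div_pow, mul_pow, Real.sq_sqrt ht0.le]

theorem Strategy.successCount_le_time_ratio (σ : Strategy n t b) (hn : 2 ≤ n)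
    (ht : t ≤ n.choose 2) {k : ℕ} (hk : 1 ≤ k) :
    (σ.successCount (triangleFan k) : ℝ) ≤
      (6 * k * 4 ^ (3 * k - 1) * (t / timeThreshold k n) ^ (3 * k)) *
        Fintype.card (EdgeOrder n) := by
  have hn0 : (0 : ℝ) < n := by exact_mod_cast (by omega : 0 < n)
  refine (σ.successCount_le_of_fan hn ht hk).trans ?_
  rw [div_pow, timeThreshold_pow hk]
  have : (t : ℝ) ^ (3 * k) = t * t ^ (3 * k - 1) := by rw [← pow_succ']; congr 1; omega
  rw [this]
  gcongr
  exact min_le_right _ _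

end UpperBounds

theorem tendsto_probContains_triangleFan_zero {k : ℕ} (hk : 1 ≤ k) {t b : ℕ → ℕ}
    (ht : ∀ᶠ n in atTop, t n ≤ n.choose 2)
    (h : Tendsto (fun n => (t n : ℝ) / timeThreshold k n) atTop (𝓝 0) ∨
      Tendsto (fun n => (b n : ℝ) / budgetThreshold k n (t n)) atTop (𝓝 0))
    (p : ∀ n, RandomizedStrategy n (t n) (b n)) :
    Tendsto (fun n => (p n).probContains (triangleFan k)) atTop (𝓝 0) := by
  have key : ∀ c : ℕ → ℝ, Tendsto c atTop (𝓝 0) →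
      (∀ n, 2 ≤ n → t n ≤ n.choose 2 → ∀ σ : Strategy n (t n) (b n),
        (σ.successCount (triangleFan k) : ℝ) ≤ c n * Fintype.card (EdgeOrder n)) →
      Tendsto (fun n => (p n).probContains (triangleFan k)) atTop (𝓝 0) := by
    intro c hc hσ
    have hc' : Tendsto (fun n => ENNReal.ofReal (c n)) atTop (𝓝 0) := by
      simpa using ENNReal.tendsto_ofReal hc
    refine tendsto_of_tendsto_of_tendsto_of_le_of_le' tendsto_const_nhds hc'
      (Eventually.of_forall fun _ => zero_le) ?_
    filter_upwards [ht, eventually_ge_atTop 2] with n htn hn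
    exact (p n).probContains_le _ _ fun σ => σ.probContains_le_ofReal _ (hσ n hn htn σ)
  rcases h with h | h
  · refine key _ ?_ fun n hn htn σ => σ.successCount_le_time_ratio hn htn hk
    have := (h.pow (3 * k)).const_mul (6 * (k : ℝ) * 4 ^ (3 * k - 1))
    rwa [zero_pow (by omega), mul_zero] at this
  · refine key _ ?_ fun n hn htn σ => σ.successCount_le_ratio hn htn hk
    have := (h.const_mul (6 * (k : ℝ) * 4 ^ (3 * k - 1))).add ((h.pow 2).const_mul 16)
    simpa using this

/-! ### Above the thresholds: success probability tends to one. -/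

theorem tendsto_descFactorial_div_pow (j : ℕ) :
    Tendsto (fun w : ℕ => (w.descFactorial j : ℝ) / (w : ℝ) ^ j) atTop (𝓝 1) := by
  induction j with
  | zero => simp
  | succ j ih =>
    have h1 : Tendsto (fun w : ℕ => ((w - j : ℕ) : ℝ) / w) atTop (𝓝 1) := by
      have h2 : Tendsto (fun w : ℕ => 1 - (j : ℝ) / w) atTop (𝓝 (1 - 0)) :=
        tendsto_const_nhds.sub (tendsto_const_div_atTop_nhds_zero_nat _)
      rw [sub_zero] at h2
      refine h2.congr' ?_
      filter_upwards [eventually_ge_atTop j, eventually_gt_atTop 0] with w hw hw0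
      have : (w : ℝ) ≠ 0 := by exact_mod_cast hw0.ne'
      rw [Nat.cast_sub hw, sub_div, div_self this]
    have := h1.mul ih
    rw [one_mul] at this
    refine this.congr fun w => ?_
    rw [Nat.descFactorial_succ, div_mul_div_comm, pow_succ]
    push_cast
    rw [mul_comm ((w : ℝ) ^ j)]

theorem eventually_exists_strategy_successCount_gt {k : ℕ} (hk : 1 ≤ k) {t b : ℕ → ℕ}
    (ht : ∀ᶠ n in atTop, t n ≤ n.choose 2)
    (htt : Tendsto (fun n => (t n : ℝ) / timeThreshold k n) atTop atTop)
    (hbt : Tendsto (fun n => (b n : ℝ) / budgetThreshold k n (t n)) atTop atTop)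
    {a : ℝ} (ha : a < 1) :
    ∀ᶠ n in atTop, ∃ σ : Strategy n (t n) (b n), σ.IsGraphBased ∧
      a * Fintype.card (EdgeOrder n) ≤ σ.successCount (triangleFan k) := by
  have hkpos : (0 : ℝ) < k := by exact_mod_cast hk
  set C : ℝ := (1 + 64 * k + 4096 * k ^ 2) ^ k with hC
  have hC0 : 0 < C := by positivity
  -- `L` is fixed before n tends to infinity; the fraction is the limit of the success bound for
  -- this `L`.
  obtain ⟨L, hL, hLa⟩ : ∃ L : ℝ, 1 ≤ L ∧ a < 1 ^ 2 / ((1 + 0) ^ k + C / L) := by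
    have h : Tendsto (fun L : ℝ => (1 : ℝ) ^ 2 / ((1 + 0) ^ k + C / L)) atTop
        (𝓝 (1 ^ 2 / ((1 + 0) ^ k + 0))) :=
      (tendsto_const_nhds).div (tendsto_const_nhds.add (tendsto_const_nhds.div_atTop tendsto_id))
        (by simp)
    have h' : a < 1 ^ 2 / ((1 + 0 : ℝ) ^ k + 0) := by simpa using ha
    exact ((eventually_ge_atTop (1 : ℝ)).and (h.eventually_const_lt h')).exists
  have hncast : Tendsto (fun n : ℕ => (n : ℝ)) atTop atTop := tendsto_natCast_atTop_atTop
  have hnt : ∀ᶠ n : ℕ in atTop, n ≤ t n := by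
    filter_upwards [htt.eventually_ge_atTop 1, eventually_ge_atTop 1] with n h hn
    have h1 := le_timeThreshold hk hn
    have h2 : (0 : ℝ) < timeThreshold k n :=
      lt_of_lt_of_le (by exact_mod_cast hn) h1
    rw [one_le_div h2] at h
    exact_mod_cast h1.trans h
  have htop : Tendsto t atTop atTop := tendsto_atTop_mono' _ hnt tendsto_id
  have htopR : Tendsto (fun n => (t n : ℝ)) atTop atTop := hncast.comp htop
  have hNtop : Tendsto (fun n : ℕ => (n.choose 2 : ℝ)) atTop atTop :=
    tendsto_atTop_mono' _ (by filter_upwards [ht] with n h; exact_mod_cast h) htopR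
  have hw₁ : Tendsto (fun n : ℕ => ⌊min (t n : ℝ) (n ^ 2 / √(t n)) / 2⌋₊) atTop atTop := by
    refine tendsto_nat_floor_atTop.comp (Tendsto.atTop_div_const two_pos ?_)
    refine tendsto_atTop_mono' _ ?_ hncast
    filter_upwards [hnt, ht, eventually_ge_atTop 1] with n h1 h2 h3
    have hn0 : (0 : ℝ) < n := by exact_mod_cast h3
    have h1' : (n : ℝ) ≤ t n := by exact_mod_cast h1
    have h2' : (t n : ℝ) ≤ n.choose 2 := by exact_mod_cast h2
    refine le_min h1' ?_
    have hs : 0 < √(t n : ℝ) := Real.sqrt_pos.2 (hn0.trans_le h1')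
    have hsn : √(t n : ℝ) ≤ n := by
      have := choose_two_add_one_le_sq h3
      exact Real.sqrt_le_iff.2 ⟨hn0.le, by linarith⟩
    rw [le_div_iff₀ hs, sq]
    gcongr
  have hw₂ : Tendsto (fun n => t n / 2) atTop atTop :=
    (Nat.tendsto_div_const_atTop two_ne_zero).comp htop
  have hM : Tendsto (fun n : ℕ => ((n.choose 2 : ℝ) + 1 - 6 * k) / n.choose 2) atTop (𝓝 1) := by
    have h1 : Tendsto (fun n : ℕ => 1 + (1 - 6 * (k : ℝ)) / n.choose 2) atTop (𝓝 (1 + 0)) :=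
      tendsto_const_nhds.add (tendsto_const_nhds.div_atTop hNtop)
    rw [add_zero] at h1
    refine h1.congr' ?_
    filter_upwards [hNtop.eventually_gt_atTop 0] with n hn
    field_simp
    ring
  have hδ : Tendsto (fun n : ℕ => (((⌊min (t n : ℝ) (n ^ 2 / √(t n)) / 2⌋₊).descFactorial (2 * k) /
            (⌊min (t n : ℝ) (n ^ 2 / √(t n)) / 2⌋₊ : ℝ) ^ (2 * k) *
          ((t n / 2).descFactorial k / ((t n / 2 : ℕ) : ℝ) ^ k) *
          (((n.choose 2 : ℝ) + 1 - 6 * k) / n.choose 2) ^ (3 * k)) ^ 2 /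
          ((1 + 256 * k ^ 2 / t n) ^ k + C / L) -
        144 * k * L * (budgetThreshold k n (t n) / b n))) atTop
      (𝓝 (((1 : ℝ) * 1 * 1 ^ (3 * k)) ^ 2 / ((1 + 0) ^ k + C / L) - 144 * k * L * 0)) := by
    refine Tendsto.sub (Tendsto.div (Tendsto.pow (Tendsto.mul (Tendsto.mul ?_ ?_) (hM.pow _)) 2)
      (((tendsto_const_nhds.add (tendsto_const_nhds.div_atTop htopR)).pow k).add
        tendsto_const_nhds) (by positivity)) (Tendsto.const_mul _ ?_)
    · exact (tendsto_descFactorial_div_pow (2 * k)).comp hw₁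
    · exact (tendsto_descFactorial_div_pow k).comp hw₂
    · refine hbt.inv_tendsto_atTop.congr fun n => ?_
      rw [Pi.inv_apply, inv_div]
  have hδa := hδ.eventually_const_lt (u := a) (by simpa using hLa)
  have hb : ∀ᶠ n in atTop, 0 < b n := by
    filter_upwards [hbt.eventually_gt_atTop 0] with n hn
    refine Nat.pos_of_ne_zero fun h => ?_
    simp [h] at hn
  have hr : ∀ᶠ n : ℕ in atTop,
      L / (min ((t n : ℝ) ^ 3 / (n : ℝ) ^ 4) 1) ^ k + 1 ≤ n / 2 := by
    have h1 : Tendsto (fun n => ((t n : ℝ) / timeThreshold k n) ^ (3 * k)) atTop atTop :=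
      (tendsto_pow_atTop (by omega)).comp htt
    -- When t^3 ≤ n^4, t^(3k) ≥ 4L n^(4k-1) gives L / μ^k ≤ n/4; otherwise μ = 1 and n ≥ 4L
    -- suffices. The remaining 4 absorbs the summand 1.
    filter_upwards [h1.eventually_ge_atTop (4 * L), hncast.eventually_ge_atTop (4 * L + 4),
      eventually_ge_atTop 1, hnt] with n h2 h3 h4 h5
    have hn0 : (0 : ℝ) < n := by exact_mod_cast h4
    have ht0 : (0 : ℝ) < t n := hn0.trans_le (by exact_mod_cast h5)
    have h6 : L / (min ((t n : ℝ) ^ 3 / (n : ℝ) ^ 4) 1) ^ k ≤ max ((n : ℝ) / 4) L := by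
      rcases le_total ((t n : ℝ) ^ 3 / (n : ℝ) ^ 4) 1 with h | h
      · refine le_max_of_le_left ?_
        rw [min_eq_left h, div_pow, ← pow_mul, ← pow_mul, div_div_eq_mul_div,
          div_le_iff₀ (by positivity)]
        rw [div_pow, timeThreshold_pow hk, le_div_iff₀ (by positivity)] at h2
        have : (n : ℝ) ^ (4 * k) = n ^ (4 * k - 1) * n := by
          rw [← pow_succ]; congr 1; omega
        rw [this]
        nlinarith
      · refine le_max_of_le_right ?_
        rw [min_eq_right h, one_pow, div_one]
    have h7 : max ((n : ℝ) / 4) L ≤ n / 4 := max_le le_rfl (by linarith)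
    linarith
  filter_upwards [hδa, hb, hr, hnt, ht, eventually_ge_atTop (48 * k)] with n h1 h2 h3 h4 h5 h6
  obtain ⟨σ, hσ, hσ'⟩ := exists_strategy_successCount_ge hk hL h6 h4 h5 h2 h3
  exact ⟨σ, hσ, le_trans (mul_le_mul_of_nonneg_right h1.le (Nat.cast_nonneg _)) hσ'⟩

/-- Success counts are natural numbers bounded by the number of orders, so a best graph-based
strategy exists; buying nothing shows that there is one at all. An optimal choice for each n
replaces a diagonal argument over the targets a < 1. -/
theorem exists_isGraphBased_forall_successCount_le {V : Type} (n t b : ℕ) (H : SimpleGraph V) :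
    ∃ σ : Strategy n t b, σ.IsGraphBased ∧
      ∀ σ' : Strategy n t b, σ'.IsGraphBased → σ'.successCount H ≤ σ.successCount H := by
  let S : Set ℕ := {c | ∃ σ : Strategy n t b, σ.IsGraphBased ∧ σ.successCount H = c}
  have hne : S.Nonempty :=
    ⟨_, Strategy.ofRule t b fun _ _ _ => False, Strategy.isGraphBased_ofRule _, rfl⟩
  have hbdd : BddAbove S := ⟨Fintype.card (EdgeOrder n), by
    rintro _ ⟨σ, -, rfl⟩; exact σ.successCount_le_card H⟩
  obtain ⟨σ, hσ, h⟩ := Nat.sSup_mem hne hbdd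
  exact ⟨σ, hσ, fun σ' hσ' => h ▸ le_csSup hbdd ⟨σ', hσ', rfl⟩⟩

theorem exists_strategies_tendsto_probContains_triangleFan_one {k : ℕ} (hk : 1 ≤ k) {t b : ℕ → ℕ}
    (ht : ∀ᶠ n in atTop, t n ≤ n.choose 2)
    (htt : Tendsto (fun n => (t n : ℝ) / timeThreshold k n) atTop atTop)
    (hbt : Tendsto (fun n => (b n : ℝ) / budgetThreshold k n (t n)) atTop atTop) :
    ∃ σ : ∀ n, Strategy n (t n) (b n), (∀ n, (σ n).IsGraphBased) ∧
      Tendsto (fun n => (σ n).toRandomized.probContains (triangleFan k)) atTop (𝓝 1) := by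
  choose σ hσ hmax using fun n =>
    exists_isGraphBased_forall_successCount_le n (t n) (b n) (triangleFan k)
  refine ⟨σ, hσ, ?_⟩
  have hT : ∀ n, (0 : ℝ) < Fintype.card (EdgeOrder n) := fun n => by
    exact_mod_cast Fintype.card_pos
  have hlim : Tendsto (fun n => ((σ n).successCount (triangleFan k) : ℝ) /
      Fintype.card (EdgeOrder n)) atTop (𝓝 1) := by
    refine tendsto_order.2 ⟨fun a ha => ?_, fun a ha => Eventually.of_forall fun n => ?_⟩
    · obtain ⟨a', haa', ha'⟩ := exists_between ha
      filter_upwards [eventually_exists_strategy_successCount_gt hk ht htt hbt ha'] with n hn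
      obtain ⟨σ', hσ', h⟩ := hn
      refine haa'.trans_le ((le_div_iff₀ (hT n)).2 (h.trans ?_))
      exact_mod_cast hmax n σ' hσ'
    · refine lt_of_le_of_lt ((div_le_one (hT n)).2 ?_) ha
      exact_mod_cast (σ n).successCount_le_card _
  have h := ENNReal.tendsto_ofReal hlim
  rw [ENNReal.ofReal_one] at h
  refine h.congr fun n => ?_
  rw [(σ n).probContains_toRandomized, ENNReal.ofReal_div_of_pos (hT n), ENNReal.ofReal_natCast,
    ENNReal.ofReal_natCast]

theorem theorem4 (k : ℕ) (hk : 1 ≤ k) (t b : ℕ → ℕ)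
    (ht : ∀ᶠ n in atTop, t n ≤ n.choose 2) :
    ((Tendsto (fun n => (t n : ℝ) / timeThreshold k n) atTop atTop ∧
        Tendsto (fun n => (b n : ℝ) / budgetThreshold k n (t n)) atTop atTop) →
      ∃ σ : ∀ n, Strategy n (t n) (b n),
        (∀ n, (σ n).IsGraphBased) ∧
        Tendsto (fun n => (σ n).toRandomized.probContains (triangleFan k)) atTop (𝓝 1)) ∧
    ((Tendsto (fun n => (t n : ℝ) / timeThreshold k n) atTop (𝓝 0) ∨
        Tendsto (fun n => (b n : ℝ) / budgetThreshold k n (t n)) atTop (𝓝 0)) →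
      ∀ p : ∀ n, RandomizedStrategy n (t n) (b n),
        Tendsto (fun n => (p n).probContains (triangleFan k)) atTop (𝓝 0)) :=
  ⟨fun h => exists_strategies_tendsto_probContains_triangleFan_one hk ht h.1 h.2,
    fun h p => tendsto_probContains_triangleFan_zero hk ht h p⟩
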